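/- **Setting.** Let $\Omega\subset\mathbb R^N$ be a bounded open set (in particular, a bounded Lipschitz domain with $N\in\{2,3\}$), let $T,\alpha,\beta,\epsilon>0$, and write $H^1_0(0,T;X)=\{z\in H^1(0,T;X): z(0)=0\}$, $H^1_T(0,T;X)=\{z\in H^1(0,T;X): z(T)=0\}$, and $\langle-\Delta u,v\rangle=\int_\Omega\nabla u\cdot\nabla v\,dx$ for $u,v\in H^1(\Omega)$. Assume: * $f:\mathbb R\to\mathbb R$ is Lipschitz continuous, directionally differentiable, and differentiable at every $v\neq n_f$, where $n_f\in\mathbb R$ is fixed. Put $f'_+(v)=f'(v;1)$ and $f'_-(v)=-f'(v;-1)$. * $\mathcal H:L^2(0,T;L^2(\Omega))\to L^2(0,T;L^2(\Omega))$ satisfies, for some $L_{\mathcal H}>0$ and all $q_1,q_2\in L^2(0,T;L^2(\Omega))$, $\|\mathcal H(q_1)(t)-\mathcal H(q_2)(t)\|_{L^2(\Omega)}\le L_{\mathcal H}\int_0^t\|q_1(s)-q_2(s)\|_{L^2(\Omega)}\,ds$ for a.e. $t\in(0,T)$. Moreover $\mathcal H$ is Gâteaux differentiable, as a self-map of $L^2(0,T;L^2(\Omega))$,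 at every point of $H^1(0,T;L^2(\Omega))$, and $q\mapsto\mathcal H'(q)$ is continuous from $H^1(0,T;L^2(\Omega))$ to the bounded linear operators on $L^2(0,T;L^2(\Omega))$. The Hilbert space adjoint of $\mathcal H'(q)$ is denoted by $\mathcal H'(q)^\star$. * $j:L^2(0,T;L^2(\Omega))\times L^2(0,T;H^1(\Omega))\to\mathbb R$ is continuously Fréchet differentiable. For $\ell\in H^1(\Omega)^*$, $\varphi\in H^1(\Omega)$ and $q\in L^2(\Omega)$ let $\mathcal E(\ell,\varphi,q)=\frac\alpha2\|\nabla\varphi\|^2_{L^2(\Omega)}+\frac\beta2\|\varphi-q\|^2_{L^2(\Omega)}-\langle\ell,\varphi\rangle$. For $\zeta,\eta\in L^2(\Omega)$ let $\mathcal R_\epsilon(\zeta,\eta)=\int_\Omega f(\zeta)\eta\,dx+\frac\epsilon2\|\eta\|^2_{L^2(\Omega)}$ if $\eta\ge0$ a.e. in $\Omega$, and $\mathcal R_\epsilon(\zeta,\eta)=\infty$ otherwise. For $\ell\in L^2(0,T;H^1(\Omega)^*)$ let $S(\ell)=(q,\varphi)\in H^1_0(0,T;L^2(\Omega))\times L^2(0,T;H^1(\Omega))$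 be the unique solution of $$\varphi(t)\in\operatorname*{argmin}_{\psi\in H^1(\Omega)}\mathcal E(\ell(t),\psi,q(t)),\qquad -\partial_q\mathcal E(\ell(t),\varphi(t),q(t))\in\partial_2\mathcal R_\epsilon(\mathcal H(q)(t),\dot q(t))\quad\text{for a.e. }t\in(0,T),$$ where $\partial_2$ is the convex subdifferential in the second argument. The space $L^2(\Omega)$ is embedded in $H^1(\Omega)^*$ in the usual way. **Proposition.** Let $\bar\ell\in H^1(0,T;L^2(\Omega))$ with states $(\bar q,\bar\varphi)=S(\bar\ell)$, and put $\bar z:=-\beta(\bar q-\bar\varphi)-f(\mathcal H(\bar q))$. Suppose that there are $\xi\in H^1_T(0,T;L^2(\Omega))$, $w\in L^2(0,T;H^1(\Omega))$ and $\lambda,\mu\in L^\infty(0,T;L^2(\Omega))$ such that $$-\dot\xi-\beta(w-\lambda)+\mathcal H'(\bar q)^\star\mu=\partial_qj(\bar q,\bar\varphi)\ \text{ in }L^2(0,T;L^2(\Omega)),$$ $$-\alpha\Delta w+\beta(w-\lambda)=\partial_\varphi j(\bar q,\bar\varphi)\ \text{ in }L^2(0,T;H^1(\Omega)^*),$$ $$\lambda=\tfrac1\epsilon\chi_{\{\bar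 z>0\}}\xi\ \text{ a.e. where }\bar z\neq0,\qquad \mu=f'(\mathcal H(\bar q))\lambda\ \text{ a.e. where }\mathcal H(\bar q)\neq n_f,$$ $$0\le\lambda\le\tfrac1\epsilon\xi\ \text{ a.e. where }\bar z=0,\qquad f'_+(n_f)\lambda\le\mu\le f'_-(n_f)\lambda\ \text{ a.e. where }\mathcal H(\bar q)=n_f,$$ $$(w,\delta\ell)_{L^2(0,T;L^2(\Omega))}+(\bar\ell,\delta\ell)_{H^1(0,T;L^2(\Omega))}=0\quad\forall\,\delta\ell\in H^1(0,T;L^2(\Omega)).$$ Then $\bar\ell$ is B-stationary: for every $\delta\ell\in H^1(0,T;L^2(\Omega))$ the directional derivative $S'(\bar\ell;\delta\ell)=\lim_{\tau\searrow0}\frac1\tau\big(S(\bar\ell+\tau\,\delta\ell)-S(\bar\ell)\big)$ exists in $H^1(0,T;L^2(\Omega))\times L^2(0,T;H^1(\Omega))$, and $$j'(S(\bar\ell))\,S'(\bar\ell;\delta\ell)+(\bar\ell,\delta\ell)_{H^1(0,T;L^2(\Omega))}\ge0 .$$ -/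

import Mathlib

open MeasureTheory Set Filter Topology
open scoped InnerProductSpace ENNReal NNReal ContDiff

noncomputable section

namespace FatigueDamage

/-! ### One-sided directional derivatives -/

section Directional

variable {X Y : Type*} [AddCommGroup X] [Module ℝ X]
  [AddCommGroup Y] [Module ℝ Y] [TopologicalSpace Y]

/-- `d` is the (one-sided) directional derivative `F'(x; h)`, that is, the limit of
`(F (x + τ h) - F x) / τ` as `τ ↘ 0`. -/
def HasDirDerivAt (F : X → Y) (d : Y) (x h : X) : Prop :=
  Tendsto (fun τ : ℝ => τ⁻¹ • (F (x + τ • h) - F x)) (𝓝[>] 0) (𝓝 d)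

end Directional

/-- The directional derivative `f'(v; h)` of a real function; it is used only for functions
that are directionally differentiable. -/
def dirDeriv (f : ℝ → ℝ) (v h : ℝ) : ℝ :=
  limUnder (𝓝[>] (0 : ℝ)) (fun τ : ℝ => τ⁻¹ • (f (v + τ • h) - f v))

/-- The right-sided derivative `f'₊(v) = f'(v; 1)`. -/
def rightDeriv (f : ℝ → ℝ) (v : ℝ) : ℝ := dirDeriv f v 1

/-- The left-sided derivative `f'₋(v) = - f'(v; -1)`. -/
def leftDeriv (f : ℝ → ℝ) (v : ℝ) : ℝ := - dirDeriv f v (-1)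

/-! ### Function spaces on the domain -/

section Space

variable {N : ℕ}

/-- `L²(Ω)`. -/
abbrev L2 (Ω : Set (EuclideanSpace ℝ (Fin N))) : Type :=
  Lp ℝ 2 (volume.restrict Ω)

/-- `L²(Ω; ℝ^N)`. -/
abbrev L2Vec (Ω : Set (EuclideanSpace ℝ (Fin N))) : Type :=
  Lp (EuclideanSpace ℝ (Fin N)) 2 (volume.restrict Ω)

/-- `g` is the weak gradient of `u` on `Ω`:
`∫_Ω u ∂_v ψ dx = - ∫_Ω (g · v) ψ dx` for all `ψ ∈ C_c^∞(Ω)` and all vectors `v`. -/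
def IsWeakGradient (Ω : Set (EuclideanSpace ℝ (Fin N))) (u : L2 Ω) (g : L2Vec Ω) : Prop :=
  ∀ ψ : EuclideanSpace ℝ (Fin N) → ℝ, ContDiff ℝ ∞ ψ → HasCompactSupport ψ → tsupport ψ ⊆ Ω →
    ∀ v : EuclideanSpace ℝ (Fin N),
      ∫ x in Ω, u x * fderiv ℝ ψ x v = - ∫ x in Ω, ⟪g x, v⟫_ℝ * ψ x

theorem memLp_test (Ω : Set (EuclideanSpace ℝ (Fin N))) {ψ : EuclideanSpace ℝ (Fin N) → ℝ}
    (h1 : Continuous ψ) (h2 : HasCompactSupport ψ) : MemLp ψ 2 (volume.restrict Ω) :=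
  (h1.memLp_of_hasCompactSupport (μ := volume) h2).restrict Ω

theorem integrable_fst (Ω : Set (EuclideanSpace ℝ (Fin N))) {ψ : EuclideanSpace ℝ (Fin N) → ℝ}
    (h1 : ContDiff ℝ ∞ ψ) (h2 : HasCompactSupport ψ) (v : EuclideanSpace ℝ (Fin N)) (u : L2 Ω) :
    Integrable (fun x => u x * fderiv ℝ ψ x v) (volume.restrict Ω) := by
  refine MemLp.integrable_mul (p := 2) (q := 2) (Lp.memLp u) (memLp_test Ω ?_ ?_)
  · exact (h1.continuous_fderiv (by simp)).clm_apply continuous_const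
  · exact h2.fderiv_apply (𝕜 := ℝ) v

theorem integrable_snd (Ω : Set (EuclideanSpace ℝ (Fin N))) {ψ : EuclideanSpace ℝ (Fin N) → ℝ}
    (h1 : ContDiff ℝ ∞ ψ) (h2 : HasCompactSupport ψ) (v : EuclideanSpace ℝ (Fin N))
    (g : L2Vec Ω) : Integrable (fun x => ⟪g x, v⟫_ℝ * ψ x) (volume.restrict Ω) :=
  MemLp.integrable_mul (p := 2) (q := 2) ((Lp.memLp g).inner_const v)
    (memLp_test Ω h1.continuous h2)

/-- The Sobolev space `H¹(Ω)` as the space of pairs `(u, ∇u)` in `L²(Ω) × L²(Ω; ℝ^N)`. It carries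
the inner product `(u, v)_{L²} + (∇u, ∇v)_{L²}`. -/
def sobolevH1 (Ω : Set (EuclideanSpace ℝ (Fin N))) :
    Submodule ℝ (WithLp 2 (L2 Ω × L2Vec Ω)) where
  carrier := {p | IsWeakGradient Ω p.fst p.snd}
  zero_mem' := by
    intro ψ h1 h2 h3 v
    have e1 : ∫ x in Ω, (0 : L2 Ω) x * fderiv ℝ ψ x v = 0 := by
      refine integral_eq_zero_of_ae ?_
      filter_upwards [Lp.coeFn_zero ℝ 2 (volume.restrict Ω)] with x hx
      rw [hx, Pi.zero_apply, zero_mul]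
    have e2 : ∫ x in Ω, ⟪(0 : L2Vec Ω) x, v⟫_ℝ * ψ x = 0 := by
      refine integral_eq_zero_of_ae ?_
      filter_upwards [Lp.coeFn_zero (EuclideanSpace ℝ (Fin N)) 2 (volume.restrict Ω)] with x hx
      rw [hx, Pi.zero_apply, inner_zero_left, zero_mul, Pi.zero_apply]
    change ∫ x in Ω, (0 : L2 Ω) x * fderiv ℝ ψ x v = - ∫ x in Ω, ⟪(0 : L2Vec Ω) x, v⟫_ℝ * ψ x
    rw [e1, e2, neg_zero]
  add_mem' := by
    intro a b ha hb ψ h1 h2 h3 v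
    have e1 : ∫ x in Ω, (a.fst + b.fst) x * fderiv ℝ ψ x v
        = (∫ x in Ω, a.fst x * fderiv ℝ ψ x v) + ∫ x in Ω, b.fst x * fderiv ℝ ψ x v := by
      rw [← integral_add (integrable_fst Ω h1 h2 v _) (integrable_fst Ω h1 h2 v _)]
      refine integral_congr_ae ?_
      filter_upwards [Lp.coeFn_add a.fst b.fst] with x hx
      rw [hx, Pi.add_apply, add_mul]
    have e2 : ∫ x in Ω, ⟪(a.snd + b.snd) x, v⟫_ℝ * ψ x
        = (∫ x in Ω, ⟪a.snd x, v⟫_ℝ * ψ x) + ∫ x in Ω, ⟪b.snd x, v⟫_ℝ * ψ x := by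
      rw [← integral_add (integrable_snd Ω h1 h2 v _) (integrable_snd Ω h1 h2 v _)]
      refine integral_congr_ae ?_
      filter_upwards [Lp.coeFn_add a.snd b.snd] with x hx
      rw [hx, Pi.add_apply, inner_add_left, add_mul]
    change ∫ x in Ω, (a.fst + b.fst) x * fderiv ℝ ψ x v
      = - ∫ x in Ω, ⟪(a.snd + b.snd) x, v⟫_ℝ * ψ x
    rw [e1, e2, ha ψ h1 h2 h3 v, hb ψ h1 h2 h3 v, neg_add]
  smul_mem' := by
    intro c a ha ψ h1 h2 h3 v
    have e1 : ∫ x in Ω, (c • a.fst) x * fderiv ℝ ψ x v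
        = c * ∫ x in Ω, a.fst x * fderiv ℝ ψ x v := by
      rw [← integral_const_mul]
      refine integral_congr_ae ?_
      filter_upwards [Lp.coeFn_smul c a.fst] with x hx
      rw [hx, Pi.smul_apply, smul_eq_mul, mul_assoc]
    have e2 : ∫ x in Ω, ⟪(c • a.snd) x, v⟫_ℝ * ψ x = c * ∫ x in Ω, ⟪a.snd x, v⟫_ℝ * ψ x := by
      rw [← integral_const_mul]
      refine integral_congr_ae ?_
      filter_upwards [Lp.coeFn_smul c a.snd] with x hx
      rw [hx, Pi.smul_apply, real_inner_smul_left, mul_assoc]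
    change ∫ x in Ω, (c • a.fst) x * fderiv ℝ ψ x v = - ∫ x in Ω, ⟪(c • a.snd) x, v⟫_ℝ * ψ x
    rw [e1, e2, ha ψ h1 h2 h3 v, mul_neg]

/-- `H¹(Ω)`. -/
abbrev H1 (Ω : Set (EuclideanSpace ℝ (Fin N))) : Type := sobolevH1 Ω

/-- `H¹(Ω)*`. -/
abbrev H1Dual (Ω : Set (EuclideanSpace ℝ (Fin N))) : Type := H1 Ω →L[ℝ] ℝ

/-- The embedding `H¹(Ω) ↪ L²(Ω)`. -/
def H1.toL2 (Ω : Set (EuclideanSpace ℝ (Fin N))) : H1 Ω →L[ℝ] L2 Ω :=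
  (WithLp.fstL 2 ℝ (L2 Ω) (L2Vec Ω)).comp (sobolevH1 Ω).subtypeL

/-- The gradient `∇ : H¹(Ω) → L²(Ω; ℝ^N)`. -/
def H1.grad (Ω : Set (EuclideanSpace ℝ (Fin N))) : H1 Ω →L[ℝ] L2Vec Ω :=
  (WithLp.sndL 2 ℝ (L2 Ω) (L2Vec Ω)).comp (sobolevH1 Ω).subtypeL

/-- The embedding `L²(Ω) ↪ H¹(Ω)*`, `⟨v, φ⟩ = (v, φ)_{L²(Ω)}`. -/
def L2.toH1Dual (Ω : Set (EuclideanSpace ℝ (Fin N))) : L2 Ω →L[ℝ] H1Dual Ω :=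
  LinearMap.mkContinuous
    { toFun := fun v => (innerSL ℝ v).comp (H1.toL2 Ω)
      map_add' := fun u v => by ext φ; simp
      map_smul' := fun c v => by ext φ; simp }
    ‖H1.toL2 Ω‖
    (fun v => by
      refine (ContinuousLinearMap.opNorm_comp_le _ _).trans ?_
      rw [innerSL_apply_norm, mul_comm])

end Space

/-! ### Vector-valued function spaces on the time interval `(0, T)` -/

section Time

/-- Lebesgue measure on `(0, T)`. -/
abbrev timeMeasure (T : ℝ) : Measure ℝ := volume.restrict (Ioo 0 T)

variable (T : ℝ) (X : Type) [NormedAddCommGroup X] [InnerProductSpace ℝ X]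

/-- The Bochner space `L²(0, T; X)`. -/
abbrev TimeL2 (X : Type) [NormedAddCommGroup X] : Type := Lp X 2 (timeMeasure T)

theorem intervalIntegrable_timeL2 {T : ℝ} {X : Type} [NormedAddCommGroup X] (v : TimeL2 T X)
    {t : ℝ} (ht : t ∈ Ioo 0 T) : IntervalIntegrable v volume 0 t := by
  rw [intervalIntegrable_iff_integrableOn_Ioc_of_le ht.1.le]
  have h : IntegrableOn v (Ioo 0 T) volume := (Lp.memLp v).integrable (by norm_num)
  exact h.mono_set fun s hs => ⟨hs.1, hs.2.trans_lt ht.2⟩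

/-- `H¹(0, T; X)` as the space of pairs `(u, u̇)` in `L²(0, T; X) × L²(0, T; X)` such that
`u(t) = c + ∫₀ᵗ u̇(s) ds` for a.e. `t` and some `c ∈ X`, i.e. such that `u` has weak derivative
`u̇`. It carries the inner product `(u, v)_{L²(0,T;X)} + (u̇, v̇)_{L²(0,T;X)}`. -/
def timeSobolev : Submodule ℝ (WithLp 2 (TimeL2 T X × TimeL2 T X)) where
  carrier := {p | ∃ c : X, ∀ᵐ t ∂(timeMeasure T), p.fst t = c + ∫ s in (0 : ℝ)..t, p.snd s}
  zero_mem' := by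
    refine ⟨0, ?_⟩
    have h0 : ∀ᵐ s ∂(timeMeasure T), (0 : TimeL2 T X) s = 0 := Lp.coeFn_zero X 2 _
    have h0' := (ae_restrict_iff' measurableSet_Ioo).1 h0
    filter_upwards [h0, ae_restrict_mem measurableSet_Ioo] with t h1 ht
    change (0 : TimeL2 T X) t = 0 + ∫ s in (0 : ℝ)..t, (0 : TimeL2 T X) s
    rw [h1, intervalIntegral.integral_congr_ae (g := fun _ => 0)]
    · simp
    · filter_upwards [h0'] with s hs hs'
      rw [uIoc_of_le ht.1.le] at hs'
      exact hs ⟨hs'.1, hs'.2.trans_lt ht.2⟩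
  add_mem' := by
    rintro a b ⟨c, hc⟩ ⟨d, hd⟩
    refine ⟨c + d, ?_⟩
    have h2 : ∀ᵐ s ∂(timeMeasure T), (a.snd + b.snd) s = a.snd s + b.snd s :=
      Lp.coeFn_add a.snd b.snd
    have h2' := (ae_restrict_iff' measurableSet_Ioo).1 h2
    filter_upwards [hc, hd, Lp.coeFn_add a.fst b.fst, ae_restrict_mem measurableSet_Ioo]
      with t h3 h4 h1 ht
    have e : ∫ s in (0 : ℝ)..t, (a.snd + b.snd) s
        = (∫ s in (0 : ℝ)..t, a.snd s) + ∫ s in (0 : ℝ)..t, b.snd s := by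
      rw [← intervalIntegral.integral_add (intervalIntegrable_timeL2 _ ht)
        (intervalIntegrable_timeL2 _ ht)]
      refine intervalIntegral.integral_congr_ae ?_
      filter_upwards [h2'] with s hs hs'
      rw [uIoc_of_le ht.1.le] at hs'
      exact hs ⟨hs'.1, hs'.2.trans_lt ht.2⟩
    change (a.fst + b.fst) t = c + d + ∫ s in (0 : ℝ)..t, (a.snd + b.snd) s
    rw [h1, Pi.add_apply, h3, h4, e]
    abel
  smul_mem' := by
    rintro r a ⟨c, hc⟩
    refine ⟨r • c, ?_⟩
    have h2 : ∀ᵐ s ∂(timeMeasure T), (r • a.snd) s = r • a.snd s := Lp.coeFn_smul r a.snd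
    have h2' := (ae_restrict_iff' measurableSet_Ioo).1 h2
    filter_upwards [hc, Lp.coeFn_smul r a.fst, ae_restrict_mem measurableSet_Ioo] with t h3 h1 ht
    have e : ∫ s in (0 : ℝ)..t, (r • a.snd) s = r • ∫ s in (0 : ℝ)..t, a.snd s := by
      rw [← intervalIntegral.integral_smul]
      refine intervalIntegral.integral_congr_ae ?_
      filter_upwards [h2'] with s hs hs'
      rw [uIoc_of_le ht.1.le] at hs'
      exact hs ⟨hs'.1, hs'.2.trans_lt ht.2⟩
    change (r • a.fst) t = r • c + ∫ s in (0 : ℝ)..t, (r • a.snd) s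
    rw [h1, Pi.smul_apply, h3, e, smul_add]

/-- `H¹(0, T; X)`. -/
abbrev TimeH1 : Type := timeSobolev T X

variable {T X}

/-- The embedding `H¹(0, T; X) ↪ L²(0, T; X)`. -/
def TimeH1.toL2 : TimeH1 T X →L[ℝ] TimeL2 T X :=
  (WithLp.fstL 2 ℝ (TimeL2 T X) (TimeL2 T X)).comp (timeSobolev T X).subtypeL

/-- The weak time derivative `H¹(0, T; X) → L²(0, T; X)`. -/
def TimeH1.dt : TimeH1 T X →L[ℝ] TimeL2 T X :=
  (WithLp.sndL 2 ℝ (TimeL2 T X) (TimeL2 T X)).comp (timeSobolev T X).subtypeL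

/-- `u(0) = 0` (for the continuous representative of `u`), i.e. `u ∈ H¹₀(0, T; X)`. -/
def TimeH1.VanishesAtZero (u : TimeH1 T X) : Prop :=
  ∀ᵐ t ∂(timeMeasure T), u.toL2 t = ∫ s in (0 : ℝ)..t, u.dt s

/-- `u(T) = 0` (for the continuous representative of `u`), i.e. `u ∈ H¹_T(0, T; X)`. -/
def TimeH1.VanishesAtEnd (u : TimeH1 T X) : Prop :=
  ∀ᵐ t ∂(timeMeasure T), u.toL2 t = - ∫ s in t..T, u.dt s

end Time

/-! ### The state system -/

section Model

variable {N : ℕ} {Ω : Set (EuclideanSpace ℝ (Fin N))} {T : ℝ}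

/-- The pointwise-in-time embedding `L²(0, T; H¹(Ω)) ↪ L²(0, T; L²(Ω))`. -/
def timeH1ToL2 : TimeL2 T (H1 Ω) →L[ℝ] TimeL2 T (L2 Ω) :=
  ContinuousLinearMap.compLpL 2 (timeMeasure T) (H1.toL2 Ω)

/-- The spatial gradient `L²(0, T; H¹(Ω)) → L²(0, T; L²(Ω; ℝ^N))`. -/
def timeGrad : TimeL2 T (H1 Ω) →L[ℝ] TimeL2 T (L2Vec Ω) :=
  ContinuousLinearMap.compLpL 2 (timeMeasure T) (H1.grad Ω)

/-- The embedding `H¹(0, T; L²(Ω)) ↪ L²(0, T; H¹(Ω)*)` of the controls into the loads. -/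
def controlToLoad : TimeH1 T (L2 Ω) →L[ℝ] TimeL2 T (H1Dual Ω) :=
  (ContinuousLinearMap.compLpL 2 (timeMeasure T) (L2.toH1Dual Ω)).comp TimeH1.toL2

/-- The assumptions on the history operator `H` on `L²(0, T; L²(Ω))`: the Volterra-type Lipschitz
estimate, and Gâteaux differentiability at the points of `H¹(0, T; L²(Ω))`, with derivative `H'`
that is continuous from `H¹(0, T; L²(Ω))` to the bounded operators on `L²(0, T; L²(Ω))`. -/
structure IsHistoryOperator (H : TimeL2 T (L2 Ω) → TimeL2 T (L2 Ω))
    (H' : TimeH1 T (L2 Ω) → (TimeL2 T (L2 Ω) →L[ℝ] TimeL2 T (L2 Ω))) : Prop where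
  lipschitz : ∃ L : ℝ, 0 < L ∧ ∀ q₁ q₂ : TimeL2 T (L2 Ω), ∀ᵐ t ∂(timeMeasure T),
    ‖H q₁ t - H q₂ t‖ ≤ L * ∫ s in (0 : ℝ)..t, ‖q₁ s - q₂ s‖
  gateaux : ∀ (q : TimeH1 T (L2 Ω)) (h : TimeL2 T (L2 Ω)),
    HasLineDerivAt ℝ H (H' q h) q.toL2 h
  continuous_deriv : Continuous H'

/-- The assumptions on the fatigue degradation function `f`: it is Lipschitz continuous,
directionally differentiable, and differentiable except possibly at the single point `n_f`. -/
structure IsFatigueFunction (f : ℝ → ℝ) (nf : ℝ) : Prop where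
  lipschitz : ∃ L : ℝ≥0, 0 < L ∧ LipschitzWith L f
  directional : ∀ v h : ℝ, ∃ d : ℝ, HasDirDerivAt f d v h
  differentiable : ∀ v : ℝ, v ≠ nf → DifferentiableAt ℝ f v

/-- The stored energy `α/2 ‖∇φ‖² + β/2 ‖φ - q‖² - ⟨ℓ, φ⟩` for the load `ℓ ∈ H¹(Ω)*`. -/
def energy (α β : ℝ) (ℓ : H1Dual Ω) (φ : H1 Ω) (q : L2 Ω) : ℝ :=
  α / 2 * ‖H1.grad Ω φ‖ ^ 2 + β / 2 * ‖H1.toL2 Ω φ - q‖ ^ 2 - ℓ φ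

open Classical in
/-- The viscous dissipation `R_ε(ζ, η)`, equal to `∫_Ω f(ζ) η dx + ε/2 ‖η‖²` if `η ≥ 0` a.e. and
to `∞` otherwise. -/
def dissipation (ε : ℝ) (f : ℝ → ℝ) (ζ η : L2 Ω) : EReal :=
  if ∀ᵐ x ∂(volume.restrict Ω), 0 ≤ η x then
    (((∫ x in Ω, f (ζ x) * η x) + ε / 2 * ‖η‖ ^ 2 : ℝ) : EReal)
  else ⊤

/-- The convex subdifferential of `F : L²(Ω) → (-∞, ∞]` at `v`. -/
def subdifferential (F : L2 Ω → EReal) (v : L2 Ω) : Set (L2 Ω) :=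
  {ζ | ∀ η : L2 Ω, F v + ((⟪ζ, η - v⟫_ℝ : ℝ) : EReal) ≤ F η}

/-- `(q, φ) ∈ H¹₀(0, T; L²(Ω)) × L²(0, T; H¹(Ω))` solves the fatigue damage problem with load `ℓ`:
for a.e. `t`, `φ(t)` minimizes the stored energy with `q(t)` fixed, and
`-∂_q E(t, φ(t), q(t)) ∈ ∂ R_ε(H(q)(t), ·)(q̇(t))`; moreover `q(0) = 0`. -/
structure IsState (α β ε : ℝ) (f : ℝ → ℝ) (H : TimeL2 T (L2 Ω) → TimeL2 T (L2 Ω))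
    (ℓ : TimeL2 T (H1Dual Ω)) (p : TimeH1 T (L2 Ω) × TimeL2 T (H1 Ω)) : Prop where
  initial : p.1.VanishesAtZero
  minimality : ∀ᵐ t ∂(timeMeasure T), ∀ φ' : H1 Ω,
    energy α β (ℓ t) (p.2 t) (p.1.toL2 t) ≤ energy α β (ℓ t) φ' (p.1.toL2 t)
  evolution : ∀ᵐ t ∂(timeMeasure T),
    - gradient (fun q' : L2 Ω => energy α β (ℓ t) (p.2 t) q') (p.1.toL2 t) ∈
      subdifferential (dissipation ε f (H p.1.toL2 t)) (p.1.dt t)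

/-- The control-to-state map `S`, sending a load `ℓ ∈ L²(0, T; H¹(Ω)*)` to the unique solution
`(q, φ)` of the fatigue damage problem. -/
def solutionMap (α β ε : ℝ) (f : ℝ → ℝ) (H : TimeL2 T (L2 Ω) → TimeL2 T (L2 Ω))
    (ℓ : TimeL2 T (H1Dual Ω)) : TimeH1 T (L2 Ω) × TimeL2 T (H1 Ω) :=
  Classical.epsilon (IsState α β ε f H ℓ)

/-- B-stationarity of the control `ℓ` for the objective `j(q, φ) + ½ ‖ℓ‖²_{H¹(0,T;L²(Ω))}`: for
every `δℓ`, the directional derivative `S'(ℓ; δℓ) = (δq, δφ)` exists and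
`j'(S(ℓ)) S'(ℓ; δℓ) + (ℓ, δℓ)_{H¹(0,T;L²(Ω))} ≥ 0`. -/
def IsBStationary (α β ε : ℝ) (f : ℝ → ℝ) (H : TimeL2 T (L2 Ω) → TimeL2 T (L2 Ω))
    (j : TimeL2 T (L2 Ω) × TimeL2 T (H1 Ω) → ℝ) (ℓ : TimeH1 T (L2 Ω)) : Prop :=
  ∀ δℓ : TimeH1 T (L2 Ω), ∃ D : TimeH1 T (L2 Ω) × TimeL2 T (H1 Ω),
    HasDirDerivAt (solutionMap α β ε f H) D (controlToLoad ℓ) (controlToLoad δℓ) ∧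
    0 ≤ fderiv ℝ j ((solutionMap α β ε f H (controlToLoad ℓ)).1.toL2,
          (solutionMap α β ε f H (controlToLoad ℓ)).2) (D.1.toL2, D.2)
        + ⟪ℓ, δℓ⟫_ℝ

/-- The value `z(t, x)` of `z = -β (q - φ) - f(H(q))`. -/
def zbar (β : ℝ) (f : ℝ → ℝ) (H : TimeL2 T (L2 Ω) → TimeL2 T (L2 Ω))
    (q : TimeH1 T (L2 Ω)) (φ : TimeL2 T (H1 Ω)) (t : ℝ) (x : EuclideanSpace ℝ (Fin N)) : ℝ :=
  -β * (q.toL2 t x - H1.toL2 Ω (φ t) x) - f (H q.toL2 t x)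

/-- The optimality system for a control `ℓ` with states `(q, φ)`, adjoint states `(ξ, w)` and
multipliers `lam, mu`. Since `lam`, `mu` and the other functions are elements of
`L²(0, T; L²(Ω))`, "a.e. in `(0, T) × Ω`" reads "for a.e. `t`, for a.e. `x`". -/
structure OptimalitySystem (α β ε : ℝ) (f : ℝ → ℝ) (nf : ℝ)
    (H : TimeL2 T (L2 Ω) → TimeL2 T (L2 Ω))
    (H' : TimeH1 T (L2 Ω) → (TimeL2 T (L2 Ω) →L[ℝ] TimeL2 T (L2 Ω)))
    (j : TimeL2 T (L2 Ω) × TimeL2 T (H1 Ω) → ℝ)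
    (ℓ : TimeH1 T (L2 Ω)) (q : TimeH1 T (L2 Ω)) (φ : TimeL2 T (H1 Ω))
    (ξ : TimeH1 T (L2 Ω)) (w : TimeL2 T (H1 Ω)) (lam mu : TimeL2 T (L2 Ω)) : Prop where
  /-- `λ ∈ L^∞(0, T; L²(Ω))` -/
  lam_bdd : MemLp lam ∞ (timeMeasure T)
  /-- `μ ∈ L^∞(0, T; L²(Ω))` -/
  mu_bdd : MemLp mu ∞ (timeMeasure T)
  /-- `-ξ̇ - β (w - λ) + H'(q)* μ = ∂_q j(q, φ)` in `L²(0, T; L²(Ω))` -/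
  adjoint_q : - ξ.dt - β • (timeH1ToL2 w - lam) + (H' q).adjoint mu
    = gradient (fun q' : TimeL2 T (L2 Ω) => j (q', φ)) q.toL2
  /-- `ξ(T) = 0` -/
  terminal : ξ.VanishesAtEnd
  /-- `-α Δ w + β (w - λ) = ∂_φ j(q, φ)` in `L²(0, T; H¹(Ω)*)` -/
  adjoint_phi : ∀ v : TimeL2 T (H1 Ω),
    α * ⟪timeGrad w, timeGrad v⟫_ℝ + β * ⟪timeH1ToL2 w - lam, timeH1ToL2 v⟫_ℝ
      = fderiv ℝ (fun φ' : TimeL2 T (H1 Ω) => j (q.toL2, φ')) φ v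
  lam_eq : ∀ᵐ t ∂(timeMeasure T), ∀ᵐ x ∂(volume.restrict Ω), zbar β f H q φ t x ≠ 0 →
    lam t x = 1 / ε * ({y | 0 < zbar β f H q φ t y}.indicator 1 x * ξ.toL2 t x)
  mu_eq : ∀ᵐ t ∂(timeMeasure T), ∀ᵐ x ∂(volume.restrict Ω), H q.toL2 t x ≠ nf →
    mu t x = deriv f (H q.toL2 t x) * lam t x
  lam_sign : ∀ᵐ t ∂(timeMeasure T), ∀ᵐ x ∂(volume.restrict Ω), zbar β f H q φ t x = 0 →
    0 ≤ lam t x ∧ lam t x ≤ 1 / ε * ξ.toL2 t x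
  mu_sign : ∀ᵐ t ∂(timeMeasure T), ∀ᵐ x ∂(volume.restrict Ω), H q.toL2 t x = nf →
    rightDeriv f nf * lam t x ≤ mu t x ∧ mu t x ≤ leftDeriv f nf * lam t x
  /-- `(w, δℓ)_{L²(0,T;L²(Ω))} + (ℓ, δℓ)_{H¹(0,T;L²(Ω))} = 0` for all `δℓ` -/
  gradient_eq : ∀ δℓ : TimeH1 T (L2 Ω), ⟪timeH1ToL2 w, δℓ.toL2⟫_ℝ + ⟪ℓ, δℓ⟫_ℝ = 0

end Model

end FatigueDamage

end

/-! The state system is an ordinary differential equation in disguise. Since the energy is strictly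
convex in φ, minimality means φ = (-αΔ + β)⁻¹(ℓ + βq) (`forall_energy_le_iff`). Since R_ε is
strongly convex in its second argument, the inclusion means q̇ = ε⁻¹ max(0, β(φ - q) - f(H(q)))
(`mem_subdifferential_dissipation_iff`). Hence p = q̇ is a fixed point of p ↦ P(A Vp + Bℓ -
Q(H(Vp))), where V integrates in time, A and B are bounded, and P, Q are superposition operators
(`isState_iff`).

This map is of Volterra type, so an iterate of it contracts. That gives existence, uniqueness, and a
bound of the distance to the fixed point by the residual, with a constant independent of the load
(`exists_norm_sub_fixedPoint_le`).

Directional differentiability of S follows. The maps P, Q, H are Lipschitz, so their directional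
derivatives are of Hadamard type and obey the chain rule. The linearized equation is again Volterra
and has a fixed point h; the trial point p̄ + τh has residual o(τ), so the residual bound puts the
perturbed solution within o(τ) of it (`exists_tendsto_solution`).

For the inequality, the adjoint equations are tested with (δq, δφ). Integration by parts and the
gradient equation eliminate ξ̇, w and δℓ (`OptimalitySystem.fderiv_eq`), leaving the integral of ξ
δq̇ - λ β(δφ - δq) + μ H'(q̄)δq. The sign conditions on the multipliers make this integrand
nonnegative pointwise (`pointwise_nonneg`). -/

namespace FatigueDamage

noncomputable section

/-! ### Directional derivatives of Lipschitz maps -/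

section DirectionalCalculus

variable {E F G : Type*} [NormedAddCommGroup E] [NormedSpace ℝ E]
  [NormedAddCommGroup F] [NormedSpace ℝ F] [NormedAddCommGroup G] [NormedSpace ℝ G]

/-- For each τ > 0 the difference quotient is L-Lipschitz in the direction, and the bound survives
the limit. This is what keeps the linearized equation of Volterra type although its coefficients are
nonlinear in the direction. -/
theorem HasDirDerivAt.norm_sub_le {g : E → F} {L : ℝ≥0} (hg : LipschitzWith L g)
    {v h₁ h₂ : E} {d₁ d₂ : F} (H₁ : HasDirDerivAt g d₁ v h₁) (H₂ : HasDirDerivAt g d₂ v h₂) :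
    ‖d₁ - d₂‖ ≤ L * ‖h₁ - h₂‖ := by
  refine le_of_tendsto (H₁.sub H₂).norm ?_
  filter_upwards [self_mem_nhdsWithin] with τ hτ
  have hτ : 0 < τ := hτ
  rw [← smul_sub, sub_sub_sub_cancel_right, norm_smul, norm_inv, Real.norm_eq_abs, abs_of_pos hτ,
    inv_mul_le_iff₀ hτ]
  refine (hg.norm_sub_le _ _).trans_eq ?_
  rw [add_sub_add_left_eq_sub, ← smul_sub, norm_smul, Real.norm_eq_abs, abs_of_pos hτ]
  ring

theorem hasDirDerivAt_zero (g : E → F) (v : E) : HasDirDerivAt g 0 v 0 := by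
  simp [HasDirDerivAt]

theorem HasDirDerivAt.norm_le {g : E → F} {L : ℝ≥0} (hg : LipschitzWith L g)
    {v h : E} {d : F} (H : HasDirDerivAt g d v h) : ‖d‖ ≤ L * ‖h‖ := by
  simpa using H.norm_sub_le hg (hasDirDerivAt_zero g v)

theorem HasDirDerivAt.unique {g : E → F} {v h : E} {d₁ d₂ : F}
    (H₁ : HasDirDerivAt g d₁ v h) (H₂ : HasDirDerivAt g d₂ v h) : d₁ = d₂ :=
  tendsto_nhds_unique H₁ H₂

/-- For Lipschitz maps, directional derivatives are Hadamard directional derivatives. -/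
theorem HasDirDerivAt.tendsto_of_tendsto {g : E → F} {L : ℝ≥0} (hg : LipschitzWith L g)
    {v h : E} {d : F} (H : HasDirDerivAt g d v h) {k : ℝ → E} (hk : Tendsto k (𝓝[>] 0) (𝓝 h)) :
    Tendsto (fun τ : ℝ => τ⁻¹ • (g (v + τ • k τ) - g v)) (𝓝[>] 0) (𝓝 d) := by
  -- Replacing the direction `k τ` by `h` changes the quotient by at most L‖k τ - h‖.
  have h0 : Tendsto (fun τ : ℝ => τ⁻¹ • (g (v + τ • k τ) - g (v + τ • h))) (𝓝[>] 0) (𝓝 0) := by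
    have h1 : Tendsto (fun τ : ℝ => (L : ℝ) * ‖k τ - h‖) (𝓝[>] 0) (𝓝 0) := by
      simpa using ((hk.sub_const h).norm.const_mul (L : ℝ))
    refine squeeze_zero_norm' ?_ h1
    filter_upwards [self_mem_nhdsWithin] with τ hτ
    have hτ : 0 < τ := hτ
    rw [norm_smul, norm_inv, Real.norm_eq_abs, abs_of_pos hτ, inv_mul_le_iff₀ hτ]
    refine (hg.norm_sub_le _ _).trans_eq ?_
    rw [add_sub_add_left_eq_sub, ← smul_sub, norm_smul, Real.norm_eq_abs, abs_of_pos hτ]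
    ring
  have := h0.add H
  rw [zero_add] at this
  refine this.congr fun τ => ?_
  rw [← smul_add, sub_add_sub_cancel]

/-- The difference quotients of `u` are moving directions converging to `d`, so Hadamard
differentiability of the outer map suffices; only `g` has to be Lipschitz. -/
theorem HasDirDerivAt.comp {g : F → G} {u : E → F} {L : ℝ≥0} (hg : LipschitzWith L g)
    {v h : E} {d : F} {e : G} (H : HasDirDerivAt g e (u v) d) (hu : HasDirDerivAt u d v h) :
    HasDirDerivAt (fun x => g (u x)) e v h := by
  refine (H.tendsto_of_tendsto hg hu).congr' ?_
  filter_upwards [self_mem_nhdsWithin] with τ hτ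
  have hτ : 0 < τ := hτ
  rw [smul_inv_smul₀ hτ.ne', add_sub_cancel]

theorem HasDirDerivAt.add {g₁ g₂ : E → F} {v h : E} {d₁ d₂ : F}
    (H₁ : HasDirDerivAt g₁ d₁ v h) (H₂ : HasDirDerivAt g₂ d₂ v h) :
    HasDirDerivAt (fun x => g₁ x + g₂ x) (d₁ + d₂) v h := by
  refine (Tendsto.add H₁ H₂).congr fun τ => ?_
  dsimp only; module

theorem HasDirDerivAt.sub {g₁ g₂ : E → F} {v h : E} {d₁ d₂ : F}
    (H₁ : HasDirDerivAt g₁ d₁ v h) (H₂ : HasDirDerivAt g₂ d₂ v h) :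
    HasDirDerivAt (fun x => g₁ x - g₂ x) (d₁ - d₂) v h := by
  refine (Tendsto.sub H₁ H₂).congr fun τ => ?_
  dsimp only; module

theorem HasDirDerivAt.clm_comp (A : F →L[ℝ] G) {g : E → F} {v h : E} {d : F}
    (H : HasDirDerivAt g d v h) : HasDirDerivAt (fun x => A (g x)) (A d) v h := by
  refine ((A.continuous.tendsto d).comp H).congr fun τ => ?_
  simp

theorem _root_.HasLineDerivAt.hasDirDerivAt {g : E → F} {v h : E} {d : F}
    (H : HasLineDerivAt ℝ g d v h) : HasDirDerivAt g d v h := by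
  refine ((hasDerivAt_iff_tendsto_slope_zero.1 H).mono_left
    (nhdsWithin_mono 0 fun τ hτ => ne_of_gt hτ)).congr fun τ => ?_
  simp

end DirectionalCalculus

/-! ### Superposition operators on L² -/

section Superposition

variable {S : Type*} [MeasurableSpace S] {μ : Measure S}
  {E F : Type*} [NormedAddCommGroup E] [NormedAddCommGroup F]

theorem norm_sq_eq_integral (u : Lp E 2 μ) : ‖u‖ ^ 2 = ∫ x, ‖u x‖ ^ 2 ∂μ := by
  have := MemLp.eLpNorm_eq_integral_rpow_norm (p := 2) (by norm_num) (by norm_num) (Lp.memLp u)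
  rw [Lp.norm_def, this, ENNReal.toReal_ofReal (by positivity)]
  have h0 : 0 ≤ ∫ x, ‖u x‖ ^ 2 ∂μ := integral_nonneg fun x => by positivity
  simp only [ENNReal.toReal_ofNat, Real.rpow_two]
  rw [← Real.rpow_natCast, ← Real.rpow_mul h0]
  norm_num

/-- Dominated convergence in `L²`. -/
theorem tendsto_lp_two_of_dominated {ι : Type*} {l : Filter ι} [l.IsCountablyGenerated]
    {u : ι → Lp E 2 μ} {v : Lp E 2 μ} {U : ι → S → E} (hU : ∀ i, u i =ᵐ[μ] U i)
    {b : S → ℝ} (hb : MemLp b 2 μ) (h1 : ∀ᶠ i in l, ∀ᵐ x ∂μ, ‖U i x - v x‖ ≤ b x)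
    (h2 : ∀ᵐ x ∂μ, Tendsto (fun i => U i x) l (𝓝 (v x))) : Tendsto u l (𝓝 v) := by
  have key : Tendsto (fun i => ‖u i - v‖ ^ 2) l (𝓝 0) := by
    have e : ∀ i, ‖u i - v‖ ^ 2 = ∫ x, ‖(u i - v) x‖ ^ 2 ∂μ := fun i => norm_sq_eq_integral _
    have e' : ∀ i, ‖u i - v‖ ^ 2 = ∫ x, ‖U i x - v x‖ ^ 2 ∂μ := fun i => by
      rw [e]
      refine integral_congr_ae ?_
      filter_upwards [hU i, Lp.coeFn_sub (u i) v] with x hx hx'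
      rw [hx', Pi.sub_apply, hx]
    simp_rw [e']
    rw [← integral_zero S ℝ (μ := μ)]
    refine tendsto_integral_filter_of_dominated_convergence (fun x => b x ^ 2) ?_ ?_ ?_ ?_
    · refine Eventually.of_forall fun i => ?_
      have : AEStronglyMeasurable (U i) μ := (Lp.aestronglyMeasurable (u i)).congr (hU i)
      exact (this.sub (Lp.aestronglyMeasurable v)).norm.pow 2
    · filter_upwards [h1] with i hi
      filter_upwards [hi] with x hx
      rw [Real.norm_of_nonneg (by positivity)]
      gcongr
    · exact hb.integrable_sq
    · filter_upwards [h2] with x hx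
      simpa using ((hx.sub_const (v x)).norm.pow 2)
  rw [tendsto_iff_norm_sub_tendsto_zero]
  have := key.sqrt
  simpa using this

theorem memLp_comp [IsFiniteMeasure μ] {g : E → F} {L : ℝ≥0} (hg : LipschitzWith L g)
    {u : S → E} (hu : MemLp u 2 μ) : MemLp (fun x => g (u x)) 2 μ := by
  -- A Lipschitz map vanishing at 0 preserves L²; the constant `g 0` is in L² because the measure is
  -- finite.
  have h1 : LipschitzWith L (fun v => g v - g 0) := by
    simpa using hg.sub (LipschitzWith.const (g 0))
  have h2 := (h1.comp_memLp (by simp) hu).add (memLp_const (g 0))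
  refine h2.ae_eq (Eventually.of_forall fun x => ?_)
  simp

variable [IsFiniteMeasure μ]

/-- The superposition operator `u ↦ g ∘ u` on `L²` of a Lipschitz function `g`. -/
def superpose {g : E → F} {L : ℝ≥0} (hg : LipschitzWith L g) (u : Lp E 2 μ) : Lp F 2 μ :=
  (memLp_comp hg (Lp.memLp u)).toLp

theorem coeFn_superpose {g : E → F} {L : ℝ≥0} (hg : LipschitzWith L g) (u : Lp E 2 μ) :
    superpose hg u =ᵐ[μ] fun x => g (u x) :=
  MemLp.coeFn_toLp _

theorem lipschitzWith_superpose {g : E → F} {L : ℝ≥0} (hg : LipschitzWith L g) :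
    LipschitzWith L (superpose hg : Lp E 2 μ → Lp F 2 μ) := by
  refine LipschitzWith.of_dist_le_mul fun u v => ?_
  rw [dist_eq_norm, dist_eq_norm]
  refine Lp.norm_le_mul_norm_of_ae_le_mul ?_
  filter_upwards [coeFn_superpose hg u, coeFn_superpose hg v, Lp.coeFn_sub u v,
    Lp.coeFn_sub (superpose hg u) (superpose hg v)] with x h1 h2 h3 h4
  rw [h4, h3, Pi.sub_apply, Pi.sub_apply, h1, h2]
  exact hg.norm_sub_le _ _

variable [NormedSpace ℝ E] [NormedSpace ℝ F]

/-- Superposition operators inherit directional differentiability. -/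
theorem exists_hasDirDerivAt_superpose {g : E → F} {L : ℝ≥0} (hg : LipschitzWith L g)
    {g' : E → E → F} (hg' : ∀ v h, HasDirDerivAt g (g' v h) v h) (u h : Lp E 2 μ) :
    ∃ D : Lp F 2 μ, (D =ᵐ[μ] fun x => g' (u x) (h x)) ∧ HasDirDerivAt (superpose hg) D u h := by
  -- No measurability of `g'` is assumed; it is inherited as a pointwise limit of difference
  -- quotients.
  have hm : AEStronglyMeasurable (fun x => g' (u x) (h x)) μ := by
    refine aestronglyMeasurable_of_tendsto_ae (𝓝[>] (0 : ℝ))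
      (f := fun τ x => τ⁻¹ • (g (u x + τ • h x) - g (u x))) (fun τ => ?_)
      (Eventually.of_forall fun x => hg' (u x) (h x))
    have h1 := Lp.aestronglyMeasurable u
    have h2 := Lp.aestronglyMeasurable h
    exact ((hg.continuous.comp_aestronglyMeasurable (h1.add (h2.const_smul τ))).sub
      (hg.continuous.comp_aestronglyMeasurable h1)).const_smul _
  have hD : MemLp (fun x => g' (u x) (h x)) 2 μ :=
    MemLp.of_le_mul (c := L) (Lp.memLp h) hm
      (Eventually.of_forall fun x => (hg' (u x) (h x)).norm_le hg)
  refine ⟨hD.toLp, hD.coeFn_toLp, ?_⟩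
  -- Quotients and limit are each bounded by L‖h x‖, hence the dominating function 2L‖h x‖.
  refine tendsto_lp_two_of_dominated (b := fun x => 2 * L * ‖h x‖)
    (U := fun τ x => τ⁻¹ • (g (u x + τ • h x) - g (u x))) (fun τ => ?_) ?_ ?_ ?_
  · filter_upwards [coeFn_superpose hg u, coeFn_superpose hg (u + τ • h), Lp.coeFn_smul τ⁻¹
      (superpose hg (u + τ • h) - superpose hg u), Lp.coeFn_sub (superpose hg (u + τ • h))
      (superpose hg u), Lp.coeFn_add u (τ • h), Lp.coeFn_smul τ h] with x h1 h2 h3 h4 h5 h6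
    rw [h3, Pi.smul_apply, h4, Pi.sub_apply, h1, h2, h5, Pi.add_apply, h6, Pi.smul_apply]
  · exact (Lp.memLp h).norm.const_mul _
  · filter_upwards [self_mem_nhdsWithin] with τ hτ
    have hτ : 0 < τ := hτ
    filter_upwards [hD.coeFn_toLp] with x hx
    rw [hx]
    refine (_root_.norm_sub_le _ _).trans ?_
    have h1 : ‖τ⁻¹ • (g (u x + τ • h x) - g (u x))‖ ≤ L * ‖h x‖ := by
      rw [norm_smul, norm_inv, Real.norm_eq_abs, abs_of_pos hτ, inv_mul_le_iff₀ hτ]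
      refine (hg.norm_sub_le _ _).trans_eq ?_
      rw [add_sub_cancel_left, norm_smul, Real.norm_eq_abs, abs_of_pos hτ]
      ring
    linarith [(hg' (u x) (h x)).norm_le hg]
  · filter_upwards [hD.coeFn_toLp] with x hx
    rw [hx]
    exact hg' (u x) (h x)

end Superposition

/-! ### Volterra operators and their fixed points -/

section Volterra

variable {T : ℝ} {X : Type} [NormedAddCommGroup X]

theorem integrable_timeL2 (p : TimeL2 T X) : IntegrableOn p (Ioo 0 T) volume :=
  (Lp.memLp p).integrable (by norm_num)

/-- Cauchy–Schwarz against the constant 1: the constant is the square root of the length of the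
interval. -/
theorem exists_integral_norm_le (T : ℝ) (X : Type) [NormedAddCommGroup X] :
    ∃ c : ℝ, 0 ≤ c ∧ ∀ p : TimeL2 T X, ∫ s in Ioo 0 T, ‖p s‖ ≤ c * ‖p‖ := by
  refine ⟨((timeMeasure T univ) ^ ((1 : ℝ) / (1 : ℝ≥0∞).toReal - 1 / (2 : ℝ≥0∞).toReal)).toReal,
    ENNReal.toReal_nonneg, fun p => ?_⟩
  have h := eLpNorm_le_eLpNorm_mul_rpow_measure_univ (p := 1) (q := 2) (by norm_num)
    (Lp.aestronglyMeasurable p)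
  rw [integral_norm_eq_lintegral_enorm (Lp.aestronglyMeasurable p),
    ← eLpNorm_one_eq_lintegral_enorm, mul_comm, Lp.norm_def, ← ENNReal.toReal_mul]
  refine ENNReal.toReal_mono (ENNReal.mul_ne_top (Lp.eLpNorm_ne_top p) ?_) h
  exact ENNReal.rpow_ne_top_of_nonneg (by norm_num) (measure_ne_top _ _)

theorem intervalIntegral_norm_le (p : TimeL2 T X) {t : ℝ} (ht : t ∈ Ioo 0 T) :
    ∫ s in (0 : ℝ)..t, ‖p s‖ ≤ ∫ s in Ioo 0 T, ‖p s‖ := by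
  rw [intervalIntegral.integral_of_le ht.1.le]
  refine setIntegral_mono_set (integrable_timeL2 p).norm
    (Eventually.of_forall fun s => norm_nonneg _) ?_
  exact (show Ioc 0 t ⊆ Ioo 0 T from fun s hs => ⟨hs.1, hs.2.trans_lt ht.2⟩).eventuallyLE

theorem intervalIntegral_mono_timeMeasure {g₁ g₂ : ℝ → ℝ} {t : ℝ} (ht : t ∈ Ioo 0 T)
    (h₁ : IntervalIntegrable g₁ volume 0 t) (h₂ : IntervalIntegrable g₂ volume 0 t)
    (h : ∀ᵐ s ∂(timeMeasure T), g₁ s ≤ g₂ s) :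
    ∫ s in (0 : ℝ)..t, g₁ s ≤ ∫ s in (0 : ℝ)..t, g₂ s := by
  rw [intervalIntegral.integral_of_le ht.1.le, intervalIntegral.integral_of_le ht.1.le]
  refine setIntegral_mono_ae_restrict h₁.1 h₂.1 ?_
  exact ae_mono (Measure.restrict_mono
    (show Ioc 0 t ⊆ Ioo 0 T from fun s hs => ⟨hs.1, hs.2.trans_lt ht.2⟩) le_rfl) h

theorem intervalIntegral_norm_sub_eq (a b : TimeL2 T X) {t : ℝ} (ht : t ∈ Ioo 0 T) :
    ∫ s in (0 : ℝ)..t, ‖a s - b s‖ = ∫ s in (0 : ℝ)..t, ‖(a - b) s‖ := by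
  have h := (ae_restrict_iff' measurableSet_Ioo).1 (Lp.coeFn_sub a b)
  refine intervalIntegral.integral_congr_ae ?_
  filter_upwards [h] with s hs hs'
  rw [uIoc_of_le ht.1.le] at hs'
  rw [hs ⟨hs'.1, hs'.2.trans_lt ht.2⟩, Pi.sub_apply]

/-- The Lipschitz estimate `‖G(a)(t) - G(b)(t)‖ ≤ K ∫₀ᵗ ‖a - b‖` for a.e. `t`. -/
def IsVolterra {Y : Type} [NormedAddCommGroup Y] (K : ℝ) (G : TimeL2 T X → TimeL2 T Y) : Prop :=
  ∀ a b : TimeL2 T X, ∀ᵐ t ∂(timeMeasure T),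
    ‖G a t - G b t‖ ≤ K * ∫ s in (0 : ℝ)..t, ‖a s - b s‖

/-- Each application of `G` adds one time integration, and repeated integration of a constant
produces tⁿ/n!. The estimate concerns differences of iterates, so linearity plays no role. -/
theorem IsVolterra.integral_iterate_le {K : ℝ} (hK : 0 ≤ K) {G : TimeL2 T X → TimeL2 T X}
    (hG : IsVolterra K G) (a b : TimeL2 T X) (n : ℕ) :
    ∀ t ∈ Ioo 0 T, ∫ s in (0 : ℝ)..t, ‖G^[n] a s - G^[n] b s‖ ≤
      (K * t) ^ n / n.factorial * ∫ s in Ioo 0 T, ‖(a - b) s‖ := by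
  induction n with
  | zero =>
    intro t ht
    simpa [intervalIntegral_norm_sub_eq a b ht] using intervalIntegral_norm_le (a - b) ht
  | succ n ih =>
    intro t ht
    set M := ∫ s in Ioo 0 T, ‖(a - b) s‖
    have h1 : ∫ s in (0 : ℝ)..t, ‖G^[n + 1] a s - G^[n + 1] b s‖ ≤
        ∫ s in (0 : ℝ)..t, K * ((K * s) ^ n / n.factorial * M) := by
      refine intervalIntegral_mono_timeMeasure ht ?_ ?_ ?_
      · exact ((intervalIntegrable_timeL2 _ ht).sub (intervalIntegrable_timeL2 _ ht)).norm
      · exact Continuous.intervalIntegrable (by fun_prop) _ _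
      · filter_upwards [hG (G^[n] a) (G^[n] b), ae_restrict_mem measurableSet_Ioo] with s hs hs'
        rw [Function.iterate_succ_apply', Function.iterate_succ_apply']
        exact hs.trans (mul_le_mul_of_nonneg_left (ih s hs') hK)
    refine h1.trans_eq ?_
    have h2 : ∀ s : ℝ, K * ((K * s) ^ n / n.factorial * M)
        = (K ^ (n + 1) / n.factorial * M) * s ^ n := fun s => by rw [mul_pow]; ring
    simp_rw [h2]
    rw [intervalIntegral.integral_const_mul, integral_pow, Nat.factorial_succ]
    push_cast
    field_simp
    ring

/-- Some iterate of a Volterra operator is a contraction, with the number of iterations and the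
Lipschitz constant of the operator depending only on the constant in the Volterra estimate. -/
theorem exists_contractingWith_iterate (T : ℝ) (X : Type) [NormedAddCommGroup X] {K : ℝ}
    (hK : 0 ≤ K) : ∃ (n : ℕ) (κ : ℝ≥0), ∀ G : TimeL2 T X → TimeL2 T X, IsVolterra K G →
      ContractingWith (1 / 2) G^[n] ∧ LipschitzWith κ G := by
  obtain ⟨c, hc, hle⟩ := exists_integral_norm_le T X
  -- The norm of the embedding of L^∞ into L² on (0, T).
  set m : ℝ := (measureUnivNNReal (timeMeasure T)) ^ (2 : ℝ≥0∞).toReal⁻¹ with hm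
  have hm0 : 0 ≤ m := by rw [hm]; positivity
  -- The last of the k + 1 applications turns the integral bound for `G^[k]` into a bound for a.e.
  -- time, which explains k! rather than (k + 1)!.
  have key : ∀ (G : TimeL2 T X → TimeL2 T X), IsVolterra K G → ∀ (k : ℕ) (a b : TimeL2 T X),
      ‖G^[k + 1] a - G^[k + 1] b‖ ≤ m * K * c * ((K * |T|) ^ k / k.factorial) * ‖a - b‖ := by
    intro G hG k a b
    have h1 : ‖G^[k + 1] a - G^[k + 1] b‖
        ≤ m * (K * ((K * |T|) ^ k / k.factorial * (c * ‖a - b‖))) := by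
      refine Lp.norm_le_of_ae_bound (by positivity) ?_
      filter_upwards [hG (G^[k] a) (G^[k] b), ae_restrict_mem measurableSet_Ioo,
        Lp.coeFn_sub (G^[k + 1] a) (G^[k + 1] b)] with s hs hs' h
      rw [h, Pi.sub_apply, Function.iterate_succ_apply', Function.iterate_succ_apply']
      refine hs.trans (mul_le_mul_of_nonneg_left ?_ hK)
      refine (hG.integral_iterate_le hK a b k s hs').trans ?_
      have h3 : K * s ≤ K * |T| := by
        gcongr
        exact hs'.2.le.trans (le_abs_self T)
      have h4 : 0 ≤ K * s := mul_nonneg hK hs'.1.le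
      exact mul_le_mul (by gcongr) (hle _) (integral_nonneg fun _ => norm_nonneg _) (by positivity)
    refine h1.trans_eq (by ring)
  have hlim := (FloorSemiring.tendsto_pow_div_factorial_atTop (K * |T|)).const_mul (m * K * c)
  rw [mul_zero] at hlim
  -- The factorial beats the power, so the constant eventually drops below 1/2.
  obtain ⟨k, hk⟩ := (hlim.eventually_le_const (show (0 : ℝ) < 1 / 2 by norm_num)).exists
  refine ⟨k + 1, Real.toNNReal (m * K * c), fun G hG => ⟨⟨?_, ?_⟩, ?_⟩⟩
  · rw [← NNReal.coe_lt_coe]; norm_num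
  · refine LipschitzWith.of_dist_le_mul fun a b => ?_
    rw [dist_eq_norm, dist_eq_norm]
    refine (key G hG k a b).trans (mul_le_mul_of_nonneg_right ?_ (norm_nonneg _))
    simpa using hk
  · refine LipschitzWith.of_dist_le_mul fun a b => ?_
    rw [dist_eq_norm, dist_eq_norm, Real.coe_toNNReal _ (by positivity)]
    simpa using key G hG 0 a b

theorem IsVolterra.exists_lipschitzWith {K : ℝ} (hK : 0 ≤ K) {G : TimeL2 T X → TimeL2 T X}
    (hG : IsVolterra K G) : ∃ κ : ℝ≥0, LipschitzWith κ G := by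
  obtain ⟨n, κ, h⟩ := exists_contractingWith_iterate T X hK
  exact ⟨κ, (h G hG).2⟩

/-- A Volterra operator has a fixed point. -/
theorem IsVolterra.exists_fixedPoint [CompleteSpace X] {K : ℝ} (hK : 0 ≤ K)
    {G : TimeL2 T X → TimeL2 T X} (hG : IsVolterra K G) : ∃ p, G p = p := by
  obtain ⟨n, κ, h⟩ := exists_contractingWith_iterate T X hK
  exact ⟨_, (h G hG).1.isFixedPt_fixedPoint_iterate⟩

/-- The distance to a fixed point of a Volterra operator is controlled by the residual. -/
theorem exists_norm_sub_fixedPoint_le (T : ℝ) (X : Type) [NormedAddCommGroup X] {K : ℝ}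
    (hK : 0 ≤ K) : ∃ C : ℝ, ∀ G : TimeL2 T X → TimeL2 T X, IsVolterra K G →
      ∀ p a : TimeL2 T X, G p = p → ‖p - a‖ ≤ C * ‖G a - a‖ := by
  obtain ⟨n, κ, h⟩ := exists_contractingWith_iterate T X hK
  -- With p fixed by G, ‖a - p‖ ≤ ‖a - Gⁿa‖ + ½‖a - p‖. Telescoping bounds the first term by ∑ κⁱ ‖a
  -- - Ga‖; absorbing the second yields the factor 2.
  refine ⟨2 * ∑ i ∈ Finset.range n, (κ : ℝ) ^ i, fun G hG p a hp => ?_⟩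
  obtain ⟨h1, h2⟩ := h G hG
  have e1 : dist (G^[n] a) p ≤ 1 / 2 * dist a p := by
    have := h1.2.dist_le_mul a p
    rwa [Function.iterate_fixed hp n] at this
  have e2 : dist a (G^[n] a) ≤ ∑ i ∈ Finset.range n, (κ : ℝ) ^ i * dist a (G a) := by
    refine (dist_le_range_sum_dist (fun i => G^[i] a) n).trans (Finset.sum_le_sum fun i _ => ?_)
    have := (h2.iterate i).dist_le_mul a (G a)
    rwa [← Function.iterate_succ_apply, NNReal.coe_pow] at this
  rw [← Finset.sum_mul] at e2
  have e3 := dist_triangle a (G^[n] a) p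
  rw [← dist_eq_norm, ← dist_eq_norm, dist_comm p a, dist_comm (G a) a]
  linarith

/-- A directional derivative of a Volterra operator satisfies the same estimate. -/
theorem IsVolterra.norm_deriv_le [NormedSpace ℝ X] {K : ℝ}
    {G : TimeL2 T X → TimeL2 T X} (hG : IsVolterra K G) {q h d : TimeL2 T X}
    (hd : HasDirDerivAt G d q h) :
    ∀ᵐ t ∂(timeMeasure T), ‖d t‖ ≤ K * ∫ s in (0 : ℝ)..t, ‖h s‖ := by
  -- L² convergence gives a.e. convergence only along a subsequence, so a sequence τₙ ↘ 0 is
  -- extracted; the pointwise bound holds for every quotient and passes to the limit.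
  have hτ : Tendsto (fun n : ℕ => ((n : ℝ) + 1)⁻¹) atTop (𝓝[>] 0) :=
    tendsto_nhdsWithin_iff.2 ⟨by simpa using tendsto_one_div_add_atTop_nhds_zero_nat (𝕜 := ℝ),
      Eventually.of_forall fun n => mem_Ioi.2 (by positivity)⟩
  obtain ⟨ns, -, hns⟩ :=
    (tendstoInMeasure_of_tendsto_Lp (Tendsto.comp hd hτ)).exists_seq_tendsto_ae
  have hle : ∀ n : ℕ, ∀ᵐ t ∂(timeMeasure T),
      ‖(((fun τ : ℝ => τ⁻¹ • (G (q + τ • h) - G q)) ∘ fun n : ℕ => ((n : ℝ) + 1)⁻¹) n) t‖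
        ≤ K * ∫ s in (0 : ℝ)..t, ‖h s‖ := by
    intro n
    set τ : ℝ := ((n : ℝ) + 1)⁻¹
    have hτ0 : 0 < τ := by positivity
    filter_upwards [hG (q + τ • h) q, Lp.coeFn_smul τ⁻¹ (G (q + τ • h) - G q),
      Lp.coeFn_sub (G (q + τ • h)) (G q), ae_restrict_mem measurableSet_Ioo] with t h1 h2 h3 ht
    rw [Function.comp_apply, h2, Pi.smul_apply, h3, Pi.sub_apply, norm_smul, norm_inv,
      Real.norm_eq_abs, abs_of_pos hτ0, inv_mul_le_iff₀ hτ0]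
    refine h1.trans_eq ?_
    rw [intervalIntegral_norm_sub_eq _ _ ht, add_sub_cancel_left]
    have h4 : ∫ s in (0 : ℝ)..t, ‖(τ • h) s‖ = τ * ∫ s in (0 : ℝ)..t, ‖h s‖ := by
      rw [← intervalIntegral.integral_const_mul]
      refine intervalIntegral.integral_congr_ae ?_
      filter_upwards [(ae_restrict_iff' measurableSet_Ioo).1 (Lp.coeFn_smul τ h)] with s hs hs'
      rw [uIoc_of_le ht.1.le] at hs'
      rw [hs ⟨hs'.1, hs'.2.trans_lt ht.2⟩, Pi.smul_apply, norm_smul, Real.norm_eq_abs,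
        abs_of_pos hτ0]
    rw [h4]; ring
  filter_upwards [hns, ae_all_iff.2 hle] with t h1 h2
  exact le_of_tendsto h1.norm (Eventually.of_forall fun i => h2 (ns i))

end Volterra

/-! ### Integration in time -/

section Primitive

variable {T : ℝ} {X : Type} [NormedAddCommGroup X] [InnerProductSpace ℝ X]

theorem norm_primitive_le (p : TimeL2 T X) {t : ℝ} (ht : t ∈ Ioo 0 T) :
    ‖∫ s in (0 : ℝ)..t, p s‖ ≤ ∫ s in Ioo 0 T, ‖p s‖ :=
  (intervalIntegral.norm_integral_le_integral_norm ht.1.le).trans (intervalIntegral_norm_le p ht)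

theorem memLp_primitive (p : TimeL2 T X) :
    MemLp (fun t => ∫ s in (0 : ℝ)..t, p s) 2 (timeMeasure T) := by
  refine MemLp.of_bound ?_ (∫ s in Ioo 0 T, ‖p s‖) ?_
  · refine ContinuousOn.aestronglyMeasurable ?_ measurableSet_Ioo
    rcases le_or_gt T 0 with hT | hT
    · simp [Ioo_eq_empty_of_le hT]
    · have h : IntegrableOn p (uIcc 0 T) volume := by
        rw [uIcc_of_le hT.le, integrableOn_Icc_iff_integrableOn_Ioo]
        exact integrable_timeL2 p
      exact (intervalIntegral.continuousOn_primitive_interval h).mono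
        (by rw [uIcc_of_le hT.le]; exact Ioo_subset_Icc_self)
  · filter_upwards [ae_restrict_mem measurableSet_Ioo] with t ht
    exact norm_primitive_le p ht

/-- The operator `p ↦ ∫₀ᵗ p(s) ds` on `L²(0, T; X)`. -/
def primitive (T : ℝ) (X : Type) [NormedAddCommGroup X] [InnerProductSpace ℝ X] :
    TimeL2 T X →L[ℝ] TimeL2 T X :=
  LinearMap.mkContinuousOfExistsBound
    { toFun := fun p => (memLp_primitive p).toLp
      map_add' := fun p₁ p₂ => by
        refine Lp.ext ?_
        have h := (ae_restrict_iff' measurableSet_Ioo).1 (Lp.coeFn_add p₁ p₂)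
        filter_upwards [(memLp_primitive p₁).coeFn_toLp, (memLp_primitive p₂).coeFn_toLp,
          (memLp_primitive (p₁ + p₂)).coeFn_toLp, ae_restrict_mem measurableSet_Ioo,
          Lp.coeFn_add (memLp_primitive p₁).toLp (memLp_primitive p₂).toLp] with t h1 h2 h3 ht h4
        rw [h4, Pi.add_apply, h1, h2, h3, ← intervalIntegral.integral_add
          (intervalIntegrable_timeL2 _ ht) (intervalIntegrable_timeL2 _ ht)]
        refine intervalIntegral.integral_congr_ae ?_
        filter_upwards [h] with s hs hs'
        rw [uIoc_of_le ht.1.le] at hs'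
        exact hs ⟨hs'.1, hs'.2.trans_lt ht.2⟩
      map_smul' := fun c p => by
        refine Lp.ext ?_
        have h := (ae_restrict_iff' measurableSet_Ioo).1 (Lp.coeFn_smul c p)
        filter_upwards [(memLp_primitive p).coeFn_toLp, (memLp_primitive (c • p)).coeFn_toLp,
          ae_restrict_mem measurableSet_Ioo, Lp.coeFn_smul c (memLp_primitive p).toLp]
          with t h1 h2 ht h3
        rw [RingHom.id_apply, h3, Pi.smul_apply, h1, h2, ← intervalIntegral.integral_smul]
        refine intervalIntegral.integral_congr_ae ?_
        filter_upwards [h] with s hs hs'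
        rw [uIoc_of_le ht.1.le] at hs'
        exact hs ⟨hs'.1, hs'.2.trans_lt ht.2⟩ }
    (by
      obtain ⟨c, hc, hle⟩ := exists_integral_norm_le T X
      refine ⟨measureUnivNNReal (timeMeasure T) ^ (2 : ℝ≥0∞).toReal⁻¹ * c, fun p => ?_⟩
      rw [mul_assoc]
      refine Lp.norm_le_of_ae_bound (by positivity) ?_
      filter_upwards [(memLp_primitive p).coeFn_toLp, ae_restrict_mem measurableSet_Ioo]
        with t h1 ht
      change ‖(memLp_primitive p).toLp _ t‖ ≤ _
      rw [h1]
      exact (norm_primitive_le p ht).trans (hle p))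

theorem coeFn_primitive (p : TimeL2 T X) :
    primitive T X p =ᵐ[timeMeasure T] fun t => ∫ s in (0 : ℝ)..t, p s :=
  (memLp_primitive p).coeFn_toLp

/-- The element of `H¹₀(0, T; X)` with a given weak derivative. -/
def TimeH1.ofDeriv (T : ℝ) (X : Type) [NormedAddCommGroup X] [InnerProductSpace ℝ X] :
    TimeL2 T X →L[ℝ] TimeH1 T X :=
  (((WithLp.prodContinuousLinearEquiv 2 ℝ (TimeL2 T X) (TimeL2 T X)).symm :
      TimeL2 T X × TimeL2 T X →L[ℝ] WithLp 2 (TimeL2 T X × TimeL2 T X)).comp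
    ((primitive T X).prod (ContinuousLinearMap.id ℝ _))).codRestrict (timeSobolev T X)
    (fun p => by
      refine ⟨0, ?_⟩
      filter_upwards [coeFn_primitive p] with t ht
      rw [zero_add]
      exact ht)

theorem TimeH1.toL2_ofDeriv (p : TimeL2 T X) : (TimeH1.ofDeriv T X p).toL2 = primitive T X p :=
  rfl

theorem TimeH1.vanishesAtZero_ofDeriv (p : TimeL2 T X) :
    (TimeH1.ofDeriv T X p).VanishesAtZero :=
  coeFn_primitive p

/-- Elements of H¹₀ are determined by their derivative, which allows q̇ in L² to be the unknown in
place of q. -/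
theorem TimeH1.VanishesAtZero.ofDeriv_dt {u : TimeH1 T X} (hu : u.VanishesAtZero) :
    TimeH1.ofDeriv T X u.dt = u := by
  have h : primitive T X u.dt = u.toL2 := Lp.ext ((coeFn_primitive u.dt).trans (EventuallyEq.symm hu))
  refine Subtype.ext ?_
  change WithLp.toLp 2 (primitive T X u.dt, u.dt) = u.1
  rw [h]
  rfl

theorem isVolterra_primitive : IsVolterra 1 (primitive T X) := by
  intro a b
  filter_upwards [coeFn_primitive (a - b), ae_restrict_mem measurableSet_Ioo,
    Lp.coeFn_sub (primitive T X a) (primitive T X b)] with t h1 ht h2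
  rw [one_mul, ← Pi.sub_apply, ← h2, ← map_sub, h1, intervalIntegral_norm_sub_eq a b ht]
  exact intervalIntegral.norm_integral_le_integral_norm ht.1.le

/-- Applying a Volterra operator after integration in time. -/
theorem IsVolterra.comp_primitive {K : ℝ} (hK : 0 ≤ K) {G : TimeL2 T X → TimeL2 T X}
    (hG : IsVolterra K G) : IsVolterra (K * T) (fun p => G (primitive T X p)) := by
  intro a b
  filter_upwards [hG (primitive T X a) (primitive T X b), ae_restrict_mem measurableSet_Ioo]
    with t h1 ht
  refine h1.trans ?_
  rw [mul_assoc]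
  refine mul_le_mul_of_nonneg_left ?_ hK
  -- The inner integral increases with its upper limit, so it is at most its value M at time t;
  -- integrating M over (0, t) costs a factor t ≤ T.
  set M := ∫ s in (0 : ℝ)..t, ‖a s - b s‖ with hM
  have hM0 : 0 ≤ M := intervalIntegral.integral_nonneg ht.1.le fun _ _ => norm_nonneg _
  have hint := ((intervalIntegrable_timeL2 a ht).sub (intervalIntegrable_timeL2 b ht)).norm
  have h2 : ∫ s in (0 : ℝ)..t, ‖primitive T X a s - primitive T X b s‖
      ≤ ∫ s in (0 : ℝ)..t, M := by
    rw [intervalIntegral.integral_of_le ht.1.le, intervalIntegral.integral_of_le ht.1.le]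
    refine setIntegral_mono_ae_restrict ?_ ?_ ?_
    · exact ((intervalIntegrable_timeL2 _ ht).sub (intervalIntegrable_timeL2 _ ht)).norm.1
    · exact integrableOn_const (by simp)
    · have := ae_mono (Measure.restrict_mono
        (show Ioc 0 t ⊆ Ioo 0 T from fun s hs => ⟨hs.1, hs.2.trans_lt ht.2⟩) le_rfl)
        (isVolterra_primitive a b)
      filter_upwards [this, ae_restrict_mem measurableSet_Ioc] with s hs hs'
      rw [one_mul] at hs
      refine hs.trans ?_
      exact intervalIntegral.integral_mono_interval le_rfl hs'.1.le hs'.2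
        (Eventually.of_forall fun _ => norm_nonneg _) hint
  refine h2.trans ?_
  rw [intervalIntegral.integral_const, sub_zero, smul_eq_mul]
  exact mul_le_mul_of_nonneg_right ht.2.le hM0

/-- Integration by parts for `ξ ∈ H¹_T(0, T; X)` against an element of `H¹₀(0, T; X)`. -/
theorem TimeH1.VanishesAtEnd.inner_dt_primitive [CompleteSpace X] {ξ : TimeH1 T X}
    (hξ : ξ.VanishesAtEnd)
    (h : TimeL2 T X) : ⟪ξ.dt, primitive T X h⟫_ℝ = - ⟪ξ.toL2, h⟫_ℝ := by
  rw [L2.inner_def, L2.inner_def, ← integral_neg]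
  -- Fubini on the triangle s ≤ t: integrating in s produces the primitive of `h`, and integrating
  -- in t produces ∫ₛᵀ ξ̇ = -ξ(s).
  set Φ : ℝ → ℝ → ℝ := fun t s => {z : ℝ × ℝ | z.2 ≤ z.1}.indicator
    (fun z => ⟪ξ.dt z.1, h z.2⟫_ℝ) (t, s) with hΦ
  have hint : Integrable (Function.uncurry Φ) ((timeMeasure T).prod (timeMeasure T)) := by
    have h1 : Integrable (fun z : ℝ × ℝ => ⟪ξ.dt z.1, h z.2⟫_ℝ)
        ((timeMeasure T).prod (timeMeasure T)) :=
      Integrable.op_fst_snd (op := fun x y : X => ⟪x, y⟫_ℝ) (continuous_inner (𝕜 := ℝ))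
        ⟨1, fun x y => by simpa using norm_inner_le_norm (𝕜 := ℝ) x y⟩ (integrable_timeL2 ξ.dt)
        (integrable_timeL2 h)
    exact h1.indicator (measurableSet_le measurable_snd measurable_fst)
  have e1 : ∀ᵐ t ∂(timeMeasure T), ⟪ξ.dt t, primitive T X h t⟫_ℝ = ∫ s in Ioo 0 T, Φ t s := by
    filter_upwards [coeFn_primitive h, ae_restrict_mem measurableSet_Ioo] with t h1 ht
    have h2 : (fun s => Φ t s) = (Iic t).indicator fun s => ⟪ξ.dt t, h s⟫_ℝ := by
      ext s
      by_cases hs : s ≤ t <;> simp [hΦ, hs]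
    rw [h1, h2, integral_indicator measurableSet_Iic, Measure.restrict_restrict measurableSet_Iic,
      show Iic t ∩ Ioo 0 T = Ioc 0 t by
        ext s; constructor
        · exact fun hs => ⟨hs.2.1, hs.1⟩
        · exact fun hs => ⟨hs.2, hs.1, hs.2.trans_lt ht.2⟩,
      intervalIntegral.integral_of_le ht.1.le, integral_inner]
    exact (intervalIntegrable_timeL2 h ht).1
  have e2 : ∀ᵐ s ∂(timeMeasure T), -⟪ξ.toL2 s, h s⟫_ℝ = ∫ t in Ioo 0 T, Φ t s := by
    filter_upwards [hξ, ae_restrict_mem measurableSet_Ioo] with s h1 hs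
    have h2 : (fun t => Φ t s) = (Ici s).indicator fun t => ⟪h s, ξ.dt t⟫_ℝ := by
      ext t
      by_cases hs : s ≤ t <;> simp [hΦ, hs, real_inner_comm]
    rw [h1, inner_neg_left, neg_neg, h2, integral_indicator measurableSet_Ici,
      Measure.restrict_restrict measurableSet_Ici,
      show Ici s ∩ Ioo 0 T = Ico s T by
        ext t; constructor
        · exact fun ht => ⟨ht.1, ht.2.2⟩
        · exact fun ht => ⟨ht.1, hs.1.trans_le ht.1, ht.2⟩,
      intervalIntegral.integral_of_le hs.2.le, ← integral_Ico_eq_integral_Ioc, integral_inner,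
      real_inner_comm]
    exact (integrable_timeL2 ξ.dt).mono_set fun t ht => ⟨hs.1.trans_le ht.1, ht.2⟩
  rw [integral_congr_ae e1, integral_congr_ae e2, integral_integral_swap hint]

end Primitive

/-! ### Bounded operators acting pointwise in time -/

section TimeLift

variable {T : ℝ} {E F G : Type} [NormedAddCommGroup E] [NormedSpace ℝ E]
  [NormedAddCommGroup F] [NormedSpace ℝ F] [NormedAddCommGroup G] [NormedSpace ℝ G]

/-- A bounded operator acting pointwise in time. -/
def timeLift (A : E →L[ℝ] F) : TimeL2 T E →L[ℝ] TimeL2 T F :=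
  A.compLpL 2 (timeMeasure T)

theorem coeFn_timeLift (A : E →L[ℝ] F) (u : TimeL2 T E) :
    timeLift A u =ᵐ[timeMeasure T] fun t => A (u t) :=
  A.coeFn_compLpL u

/-- The function `R ℓ(t) + C q(t)`. -/
def affinePotential (R : E →L[ℝ] G) (C : F →L[ℝ] G) (ℓ : TimeL2 T E) (q : TimeL2 T F) :
    TimeL2 T G :=
  timeLift R ℓ + timeLift C q

theorem coeFn_affinePotential (R : E →L[ℝ] G) (C : F →L[ℝ] G) (ℓ : TimeL2 T E)
    (q : TimeL2 T F) :
    affinePotential R C ℓ q =ᵐ[timeMeasure T] fun t => R (ℓ t) + C (q t) := by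
  filter_upwards [Lp.coeFn_add (timeLift R ℓ) (timeLift C q), coeFn_timeLift R ℓ,
    coeFn_timeLift C q] with t h1 h2 h3
  rw [affinePotential, h1, Pi.add_apply, h2, h3]

theorem tendsto_affinePotential (R : E →L[ℝ] G) (C : F →L[ℝ] G) (ℓ δℓ : TimeL2 T E)
    {p : ℝ → TimeL2 T F} {q δq : TimeL2 T F}
    (h : Tendsto (fun τ : ℝ => τ⁻¹ • (p τ - q)) (𝓝[>] 0) (𝓝 δq)) :
    Tendsto (fun τ : ℝ =>
      τ⁻¹ • (affinePotential R C (ℓ + τ • δℓ) (p τ) - affinePotential R C ℓ q))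
      (𝓝[>] 0) (𝓝 (affinePotential R C δℓ δq)) := by
  refine ((((timeLift C).continuous.tendsto δq).comp h).const_add (timeLift R δℓ)).congr' ?_
  filter_upwards [self_mem_nhdsWithin] with τ hτ
  have hτ : 0 < τ := hτ
  simp only [affinePotential, Function.comp_apply, map_add, map_smul, map_sub]
  rw [add_sub_add_comm, add_sub_cancel_left, smul_add, inv_smul_smul₀ hτ.ne']

end TimeLift

/-! ### The evolution equation and its linearization -/

section AbstractEvolution

variable {T : ℝ} {X U : Type} [NormedAddCommGroup X] [InnerProductSpace ℝ X]
  [NormedAddCommGroup U] [NormedSpace ℝ U]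
  {P Q : X → X} {LP LQ : ℝ≥0}

/-- The argument `A q + B ℓ - Q(H(q))` of the nonlinearity in the evolution equation
`q̇ = P(A q + B ℓ - Q(H(q)))`. -/
def drivingForce (hQ : LipschitzWith LQ Q) (A : X →L[ℝ] X) (B : U →L[ℝ] X)
    (H : TimeL2 T X → TimeL2 T X) (ℓ : TimeL2 T U) (q : TimeL2 T X) : TimeL2 T X :=
  A.compLpL 2 (timeMeasure T) q + B.compLpL 2 (timeMeasure T) ℓ - superpose hQ (H q)

theorem coeFn_drivingForce (hQ : LipschitzWith LQ Q) (A : X →L[ℝ] X) (B : U →L[ℝ] X)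
    (H : TimeL2 T X → TimeL2 T X) (ℓ : TimeL2 T U) (q : TimeL2 T X) :
    drivingForce hQ A B H ℓ q =ᵐ[timeMeasure T] fun t => A (q t) + B (ℓ t) - Q (H q t) := by
  filter_upwards [Lp.coeFn_sub (A.compLpL 2 (timeMeasure T) q + B.compLpL 2 (timeMeasure T) ℓ)
    (superpose hQ (H q)), Lp.coeFn_add (A.compLpL 2 (timeMeasure T) q)
    (B.compLpL 2 (timeMeasure T) ℓ), A.coeFn_compLpL q, B.coeFn_compLpL ℓ,
    coeFn_superpose hQ (H q)] with t h1 h2 h3 h4 h5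
  rw [drivingForce, h1, Pi.sub_apply, h2, Pi.add_apply, h3, h4, h5]

/-- The fixed points of this operator are the time derivatives of the solutions of
`q̇ = P(A q + B ℓ - Q(H(q)))`, `q(0) = 0`. -/
def evolutionMap (hP : LipschitzWith LP P) (hQ : LipschitzWith LQ Q) (A : X →L[ℝ] X)
    (B : U →L[ℝ] X) (H : TimeL2 T X → TimeL2 T X) (ℓ : TimeL2 T U) (p : TimeL2 T X) :
    TimeL2 T X :=
  superpose hP (drivingForce hQ A B H ℓ (primitive T X p))

/-- After integration, A contributes ‖A‖ and Q ∘ H contributes LQ · L · T; P multiplies both by LP.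
The load cancels in differences, so the constant is uniform in `ℓ`. -/
theorem isVolterra_evolutionMap (hP : LipschitzWith LP P) (hQ : LipschitzWith LQ Q)
    (A : X →L[ℝ] X) (B : U →L[ℝ] X) {H : TimeL2 T X → TimeL2 T X} {L : ℝ} (hL : 0 ≤ L)
    (hH : IsVolterra L H) (ℓ : TimeL2 T U) :
    IsVolterra (LP * (‖A‖ + LQ * (L * T))) (evolutionMap hP hQ A B H ℓ) := by
  intro a b
  filter_upwards [coeFn_superpose hP (drivingForce hQ A B H ℓ (primitive T X a)),
    coeFn_superpose hP (drivingForce hQ A B H ℓ (primitive T X b)),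
    coeFn_drivingForce hQ A B H ℓ (primitive T X a),
    coeFn_drivingForce hQ A B H ℓ (primitive T X b),
    isVolterra_primitive a b, hH.comp_primitive hL a b] with t h1 h2 h3 h4 h5 h6
  rw [evolutionMap, evolutionMap, h1, h2, h3, h4, mul_assoc]
  refine (hP.norm_sub_le _ _).trans (mul_le_mul_of_nonneg_left ?_ LP.2)
  have e : A (primitive T X a t) + B (ℓ t) - Q (H (primitive T X a) t)
      - (A (primitive T X b t) + B (ℓ t) - Q (H (primitive T X b) t))
      = A (primitive T X a t - primitive T X b t)
        - (Q (H (primitive T X a) t) - Q (H (primitive T X b) t)) := by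
    rw [map_sub]; abel
  rw [e]
  refine (norm_sub_le _ _).trans ?_
  rw [one_mul] at h5
  have h7 := (A.le_opNorm (primitive T X a t - primitive T X b t)).trans
    (mul_le_mul_of_nonneg_left h5 (norm_nonneg _))
  have h8 := (hQ.norm_sub_le (H (primitive T X a) t) (H (primitive T X b) t)).trans
    (mul_le_mul_of_nonneg_left h6 LQ.2)
  refine (add_le_add h7 h8).trans_eq ?_
  ring

/-- The directional derivative of the solution of `q̇ = P(A q + B ℓ - Q(H(q)))`, `q(0) = 0`, with
respect to `ℓ` exists; it solves the linearized equation. -/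
theorem exists_tendsto_solution [CompleteSpace X] (hT : 0 < T)
    (hP : LipschitzWith LP P) (hQ : LipschitzWith LQ Q)
    {P' Q' : X → X → X} (hP' : ∀ v h, HasDirDerivAt P (P' v h) v h)
    (hQ' : ∀ v h, HasDirDerivAt Q (Q' v h) v h)
    (A : X →L[ℝ] X) (B : U →L[ℝ] X) {H : TimeL2 T X → TimeL2 T X} {L : ℝ} (hL : 0 ≤ L)
    (hH : IsVolterra L H) (ℓ δℓ : TimeL2 T U) {p : ℝ → TimeL2 T X} {pbar : TimeL2 T X}
    (hp : ∀ τ, evolutionMap hP hQ A B H (ℓ + τ • δℓ) (p τ) = p τ)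
    (hpbar : evolutionMap hP hQ A B H ℓ pbar = pbar)
    {H' : TimeL2 T X →L[ℝ] TimeL2 T X}
    (hH' : ∀ h, HasDirDerivAt H (H' h) (primitive T X pbar) h) :
    ∃ h : TimeL2 T X,
      (∀ᵐ t ∂(timeMeasure T), h t = P' (drivingForce hQ A B H ℓ (primitive T X pbar) t)
        (A (primitive T X h t) + B (δℓ t)
          - Q' (H (primitive T X pbar) t) (H' (primitive T X h) t))) ∧
      Tendsto (fun τ : ℝ => τ⁻¹ • (p τ - pbar)) (𝓝[>] 0) (𝓝 h) := by
  set V := primitive T X with hV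
  set z := drivingForce hQ A B H ℓ (V pbar) with hz
  -- The Volterra estimate makes `H` Lipschitz on L², which turns its Gâteaux derivative into a
  -- Hadamard one for the chain rule.
  obtain ⟨κ, hκ⟩ := hH.exists_lipschitzWith hL
  choose DQ hDQ hDQ' using fun k => exists_hasDirDerivAt_superpose hQ hQ' (H (V pbar)) k
  choose DP hDP hDP' using fun k => exists_hasDirDerivAt_superpose hP hP' z k
  set force : TimeL2 T X → TimeL2 T X := fun h =>
    A.compLpL 2 (timeMeasure T) (V h) + B.compLpL 2 (timeMeasure T) δℓ - DQ (H' (V h)) with hforce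
  have hforce_coe : ∀ h, ∀ᵐ t ∂(timeMeasure T),
      force h t = A (V h t) + B (δℓ t) - Q' (H (V pbar) t) (H' (V h) t) := by
    intro h
    filter_upwards [Lp.coeFn_sub (A.compLpL 2 (timeMeasure T) (V h)
      + B.compLpL 2 (timeMeasure T) δℓ) (DQ (H' (V h))),
      Lp.coeFn_add (A.compLpL 2 (timeMeasure T) (V h)) (B.compLpL 2 (timeMeasure T) δℓ),
      A.coeFn_compLpL (V h), B.coeFn_compLpL δℓ, hDQ (H' (V h))] with t h1 h2 h3 h4 h5
    rw [hforce, h1, Pi.sub_apply, h2, Pi.add_apply, h3, h4, h5]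
  have hH'V : IsVolterra L H' := by
    intro a b
    filter_upwards [hH.norm_deriv_le (hH' (a - b)), Lp.coeFn_sub (H' a) (H' b),
      ae_restrict_mem measurableSet_Ioo] with t h1 h2 ht
    rwa [← Pi.sub_apply, ← h2, ← map_sub, intervalIntegral_norm_sub_eq a b ht]
  -- The linearized map satisfies the estimate with the same constant, because directional
  -- derivatives inherit the Lipschitz constants in their direction.
  have hlin : IsVolterra (LP * (‖A‖ + LQ * (L * T))) (fun h => DP (force h)) := by
    intro a b
    filter_upwards [hDP (force a), hDP (force b), hforce_coe a, hforce_coe b,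
      isVolterra_primitive a b, hH'V.comp_primitive hL a b] with t h1 h2 h3 h4 h5 h6
    rw [h1, h2, h3, h4, mul_assoc]
    refine ((hP' _ _).norm_sub_le hP (hP' _ _)).trans (mul_le_mul_of_nonneg_left ?_ LP.2)
    have e : A (V a t) + B (δℓ t) - Q' (H (V pbar) t) (H' (V a) t)
        - (A (V b t) + B (δℓ t) - Q' (H (V pbar) t) (H' (V b) t))
        = A (V a t - V b t)
          - (Q' (H (V pbar) t) (H' (V a) t) - Q' (H (V pbar) t) (H' (V b) t)) := by
      rw [map_sub]; abel
    rw [e]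
    refine (norm_sub_le _ _).trans ?_
    rw [one_mul] at h5
    have h7 := (A.le_opNorm (V a t - V b t)).trans
      (mul_le_mul_of_nonneg_left h5 (norm_nonneg _))
    have h8 := ((hQ' (H (V pbar) t) (H' (V a) t)).norm_sub_le hQ
      (hQ' (H (V pbar) t) (H' (V b) t))).trans (mul_le_mul_of_nonneg_left h6 LQ.2)
    refine (add_le_add h7 h8).trans_eq ?_
    ring
  have hK : 0 ≤ (LP : ℝ) * (‖A‖ + LQ * (L * T)) := by positivity
  obtain ⟨h, hh⟩ := hlin.exists_fixedPoint hK
  refine ⟨h, ?_, ?_⟩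
  · filter_upwards [hDP (force h), hforce_coe h] with t h1 h2
    rw [← h2, ← h1]
    exact congrArg (fun k : TimeL2 T X => k t) hh.symm
  · have hline : ∀ {Y : Type} [NormedAddCommGroup Y] [NormedSpace ℝ Y] (y k : Y),
        HasDirDerivAt (fun τ : ℝ => y + τ • k) k 0 1 := by
      intro Y _ _ y k
      refine tendsto_const_nhds.congr' ?_
      filter_upwards [self_mem_nhdsWithin] with τ hτ
      have hτ : 0 < τ := hτ
      simp [smul_smul, inv_mul_cancel₀ hτ.ne']
    -- Along the line τ ↦ (ℓ + τ δℓ, p̄ + τ h) the chain rule gives the evolution map the derivative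
    -- `DP (force h)`, which is `h` itself by the choice of `h`.
    have hdir : HasDirDerivAt (fun τ : ℝ => evolutionMap hP hQ A B H (ℓ + τ • δℓ)
        (pbar + τ • h)) h 0 1 := by
      have hh' : DP (force h) = h := hh
      have d1 : HasDirDerivAt (fun τ : ℝ => V (pbar + τ • h)) (V h) 0 1 :=
        (hline pbar h).clm_comp V
      have d2 := (hline ℓ δℓ).clm_comp (B.compLpL 2 (timeMeasure T))
      have d3 : HasDirDerivAt (fun τ : ℝ => H (V (pbar + τ • h))) (H' (V h)) 0 1 := by
        refine HasDirDerivAt.comp (g := H) (u := fun τ : ℝ => V (pbar + τ • h)) hκ ?_ d1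
        simpa using hH' (V h)
      have d4 : HasDirDerivAt (fun τ : ℝ => superpose hQ (H (V (pbar + τ • h))))
          (DQ (H' (V h))) 0 1 := by
        refine HasDirDerivAt.comp (g := superpose hQ) (lipschitzWith_superpose hQ) ?_ d3
        simpa using hDQ' (H' (V h))
      have d5 : HasDirDerivAt (fun τ : ℝ => drivingForce hQ A B H (ℓ + τ • δℓ)
          (V (pbar + τ • h))) (force h) 0 1 :=
        ((d1.clm_comp (A.compLpL 2 (timeMeasure T))).add d2).sub d4
      have d6 : HasDirDerivAt (fun τ : ℝ => superpose hP (drivingForce hQ A B H (ℓ + τ • δℓ)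
          (V (pbar + τ • h)))) (DP (force h)) 0 1 := by
        refine HasDirDerivAt.comp (g := superpose hP) (lipschitzWith_superpose hP) ?_ d5
        simpa using hDP' (force h)
      rwa [hh'] at d6
    -- By `hdir` the residual at p̄ + τh is o(τ). As C depends only on the Volterra constant, it
    -- serves for all loads ℓ + τ δℓ at once.
    obtain ⟨C, hC⟩ := exists_norm_sub_fixedPoint_le T X hK
    have hres : Tendsto (fun τ : ℝ => C * ‖τ⁻¹ • (evolutionMap hP hQ A B H (ℓ + τ • δℓ)
        (pbar + τ • h) - pbar) - h‖) (𝓝[>] 0) (𝓝 0) := by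
      have := ((Tendsto.sub_const hdir h).norm.const_mul C)
      rw [sub_self, norm_zero, mul_zero] at this
      refine this.congr fun τ => ?_
      simp only [zero_smul, add_zero, zero_add, smul_eq_mul, mul_one, hpbar]
    rw [tendsto_iff_norm_sub_tendsto_zero]
    refine squeeze_zero' (Eventually.of_forall fun _ => norm_nonneg _) ?_ hres
    filter_upwards [self_mem_nhdsWithin] with τ hτ
    have hτ : 0 < τ := hτ
    have h1 := hC _ (isVolterra_evolutionMap hP hQ A B hL hH (ℓ + τ • δℓ)) (p τ) (pbar + τ • h)
      (hp τ)
    have e1 : ∀ y : TimeL2 T X, ‖τ⁻¹ • (y - pbar) - h‖ = τ⁻¹ * ‖y - (pbar + τ • h)‖ := by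
      intro y
      have : τ⁻¹ • (y - pbar) - h = τ⁻¹ • (y - (pbar + τ • h)) := by
        rw [← sub_sub, smul_sub τ⁻¹ (y - pbar), inv_smul_smul₀ hτ.ne']
      rw [this, norm_smul, norm_inv, Real.norm_eq_abs, abs_of_pos hτ]
    rw [e1, e1, ← mul_assoc, mul_comm C, mul_assoc]
    exact mul_le_mul_of_nonneg_left h1 (by positivity)

/-- Existence of a solution of `q̇ = P(A q + B ℓ - Q(H(q)))`, `q(0) = 0`. -/
theorem exists_evolutionMap_eq [CompleteSpace X] (hT : 0 < T) (hP : LipschitzWith LP P)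
    (hQ : LipschitzWith LQ Q) (A : X →L[ℝ] X) (B : U →L[ℝ] X) {H : TimeL2 T X → TimeL2 T X}
    {L : ℝ} (hL : 0 ≤ L) (hH : IsVolterra L H) (ℓ : TimeL2 T U) :
    ∃ p, evolutionMap hP hQ A B H ℓ p = p :=
  (isVolterra_evolutionMap hP hQ A B hL hH ℓ).exists_fixedPoint (by positivity)

theorem evolutionMap_unique (hT : 0 < T) (hP : LipschitzWith LP P)
    (hQ : LipschitzWith LQ Q) (A : X →L[ℝ] X) (B : U →L[ℝ] X) {H : TimeL2 T X → TimeL2 T X}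
    {L : ℝ} (hL : 0 ≤ L) (hH : IsVolterra L H) (ℓ : TimeL2 T U) {p₁ p₂ : TimeL2 T X}
    (h₁ : evolutionMap hP hQ A B H ℓ p₁ = p₁) (h₂ : evolutionMap hP hQ A B H ℓ p₂ = p₂) :
    p₁ = p₂ := by
  obtain ⟨C, hC⟩ := exists_norm_sub_fixedPoint_le T X
    (K := LP * (‖A‖ + LQ * (L * T))) (by positivity)
  have := hC _ (isVolterra_evolutionMap hP hQ A B hL hH ℓ) p₁ p₂ h₁
  rw [h₂, sub_self, norm_zero, mul_zero] at this
  exact sub_eq_zero.1 (norm_le_zero_iff.1 this)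

/-- Directional differentiability of a solution operator `ℓ ↦ (q, R ℓ + C q)`, where `q` solves
`q̇ = P(A q + B ℓ - Q(H(q)))`, `q(0) = 0`. -/
theorem exists_hasDirDerivAt_solution [CompleteSpace X] {W : Type} [NormedAddCommGroup W]
    [NormedSpace ℝ W] (hT : 0 < T)
    (hP : LipschitzWith LP P) (hQ : LipschitzWith LQ Q)
    {P' Q' : X → X → X} (hP' : ∀ v h, HasDirDerivAt P (P' v h) v h)
    (hQ' : ∀ v h, HasDirDerivAt Q (Q' v h) v h)
    (A : X →L[ℝ] X) (B : U →L[ℝ] X) (R : U →L[ℝ] W) (C : X →L[ℝ] W)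
    {H : TimeL2 T X → TimeL2 T X} {L : ℝ} (hL : 0 ≤ L) (hH : IsVolterra L H)
    {S : TimeL2 T U → TimeH1 T X × TimeL2 T W}
    (hS : ∀ ℓ p, evolutionMap hP hQ A B H ℓ p = p →
      S ℓ = (TimeH1.ofDeriv T X p, affinePotential R C ℓ (primitive T X p)))
    (ℓ δℓ : TimeL2 T U) {pbar : TimeL2 T X} (hpbar : evolutionMap hP hQ A B H ℓ pbar = pbar)
    {H' : TimeL2 T X →L[ℝ] TimeL2 T X}
    (hH' : ∀ h, HasDirDerivAt H (H' h) (primitive T X pbar) h) :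
    ∃ h : TimeL2 T X,
      HasDirDerivAt S (TimeH1.ofDeriv T X h, affinePotential R C δℓ (primitive T X h)) ℓ δℓ ∧
      ∀ᵐ t ∂(timeMeasure T), h t = P' (drivingForce hQ A B H ℓ (primitive T X pbar) t)
        (A (primitive T X h t) + B (δℓ t)
          - Q' (H (primitive T X pbar) t) (H' (primitive T X h) t)) := by
  choose p hp using fun τ : ℝ => exists_evolutionMap_eq hT hP hQ A B hL hH (ℓ + τ • δℓ)
  obtain ⟨h, hh, hlim⟩ := exists_tendsto_solution hT hP hQ hP' hQ' A B hL hH ℓ δℓ hp hpbar hH'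
  refine ⟨h, ?_, hh⟩
  have l1 : Tendsto (fun τ : ℝ => τ⁻¹ • (TimeH1.ofDeriv T X (p τ) - TimeH1.ofDeriv T X pbar))
      (𝓝[>] 0) (𝓝 (TimeH1.ofDeriv T X h)) := by
    refine (((TimeH1.ofDeriv T X).continuous.tendsto h).comp hlim).congr fun τ => ?_
    rw [Function.comp_apply, map_smul, map_sub]
  have l2 : Tendsto (fun τ : ℝ => τ⁻¹ • (primitive T X (p τ) - primitive T X pbar)) (𝓝[>] 0)
      (𝓝 (primitive T X h)) := by
    refine (((primitive T X).continuous.tendsto h).comp hlim).congr fun τ => ?_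
    rw [Function.comp_apply, map_smul, map_sub]
  refine (l1.prodMk_nhds (tendsto_affinePotential R C ℓ δℓ l2)).congr fun τ => ?_
  rw [hS _ _ (hp τ), hS _ _ hpbar]
  rfl

end AbstractEvolution

/-! ### Lax–Milgram and the elliptic equation for φ -/

section LaxMilgram

variable {V : Type*} [NormedAddCommGroup V] [InnerProductSpace ℝ V] [CompleteSpace V]
  {B : V →L[ℝ] V →L[ℝ] ℝ}

theorem _root_.IsCoercive.injective (hB : IsCoercive B) : Function.Injective B := by
  intro u v huv
  refine hB.continuousLinearEquivOfBilin.injective (ext_inner_right ℝ fun w => ?_)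
  rw [hB.continuousLinearEquivOfBilin_apply, hB.continuousLinearEquivOfBilin_apply, huv]

/-- Lax–Milgram combined with Riesz representation shows that `B` is onto the dual; the inverse is
bounded by the open mapping theorem. -/
theorem _root_.IsCoercive.exists_rightInverse (hB : IsCoercive B) :
    ∃ R : (V →L[ℝ] ℝ) →L[ℝ] V, ∀ ℓ, B (R ℓ) = ℓ := by
  have hsurj : Function.Surjective B := by
    intro ℓ
    refine ⟨hB.continuousLinearEquivOfBilin.symm ((InnerProductSpace.toDual ℝ V).symm ℓ), ?_⟩
    ext w
    rw [← hB.continuousLinearEquivOfBilin_apply, ContinuousLinearEquiv.apply_symm_apply,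
      InnerProductSpace.toDual_symm_apply]
  exact ⟨(ContinuousLinearEquiv.ofBijective B (LinearMap.ker_eq_bot.2 hB.injective)
    (LinearMap.range_eq_top.2 hsurj)).symm,
    fun ℓ => ContinuousLinearEquiv.ofBijective_apply_symm_apply _ _ _ ℓ⟩

end LaxMilgram

section Elliptic

variable {N : ℕ} {Ω : Set (EuclideanSpace ℝ (Fin N))}

/-- For fixed test function and vector, the weak gradient identity equates two continuous
functionals, namely inner products with fixed L² functions. The space is an intersection of such
closed sets; completeness is needed for Lax–Milgram. -/
theorem isClosed_sobolevH1 (Ω : Set (EuclideanSpace ℝ (Fin N))) :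
    IsClosed (sobolevH1 Ω : Set (WithLp 2 (L2 Ω × L2Vec Ω))) := by
  have h : (sobolevH1 Ω : Set (WithLp 2 (L2 Ω × L2Vec Ω))) =
      {p | IsWeakGradient Ω p.fst p.snd} := rfl
  rw [h]
  simp only [IsWeakGradient, ofPred_forall]
  refine isClosed_iInter fun ψ => isClosed_iInter fun h1 => isClosed_iInter fun h2 =>
    isClosed_iInter fun _ => isClosed_iInter fun v => ?_
  have m1 : MemLp (fun x => fderiv ℝ ψ x v) 2 (volume.restrict Ω) :=
    memLp_test Ω ((h1.continuous_fderiv (by simp)).clm_apply continuous_const)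
      (h2.fderiv_apply (𝕜 := ℝ) v)
  have m2 : MemLp (fun x => ψ x • v) 2 (volume.restrict Ω) := by
    refine MemLp.of_le_mul (c := ‖v‖) (memLp_test Ω h1.continuous h2)
      (h1.continuous.smul continuous_const).aestronglyMeasurable
      (Eventually.of_forall fun x => ?_)
    rw [norm_smul, mul_comm]
  have e1 : ∀ u : L2 Ω, ∫ x in Ω, u x * fderiv ℝ ψ x v = ⟪u, m1.toLp⟫_ℝ := by
    intro u
    rw [L2.inner_def]
    refine integral_congr_ae ?_
    filter_upwards [m1.coeFn_toLp] with x hx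
    rw [hx]
    simp [mul_comm]
  have e2 : ∀ g : L2Vec Ω, ∫ x in Ω, ⟪g x, v⟫_ℝ * ψ x = ⟪g, m2.toLp⟫_ℝ := by
    intro g
    rw [L2.inner_def]
    refine integral_congr_ae ?_
    filter_upwards [m2.coeFn_toLp] with x hx
    rw [hx, real_inner_smul_right, mul_comm]
  simp only [e1, e2]
  have c1 : Continuous fun p : WithLp 2 (L2 Ω × L2Vec Ω) => p.fst :=
    (WithLp.fstL 2 ℝ (L2 Ω) (L2Vec Ω)).continuous
  have c2 : Continuous fun p : WithLp 2 (L2 Ω × L2Vec Ω) => p.snd :=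
    (WithLp.sndL 2 ℝ (L2 Ω) (L2Vec Ω)).continuous
  exact isClosed_eq (c1.inner continuous_const) (c2.inner continuous_const).neg

instance completeSpace_H1 (Ω : Set (EuclideanSpace ℝ (Fin N))) : CompleteSpace (H1 Ω) :=
  (isClosed_sobolevH1 Ω).completeSpace_coe

theorem H1.norm_sq_eq (u : H1 Ω) : ‖u‖ ^ 2 = ‖H1.toL2 Ω u‖ ^ 2 + ‖H1.grad Ω u‖ ^ 2 :=
  WithLp.prod_norm_sq_eq_of_L2 (u : WithLp 2 (L2 Ω × L2Vec Ω))

/-- The bilinear form `α (∇u, ∇v) + β (u, v)` on `H¹(Ω)`. -/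
def ellipticForm (Ω : Set (EuclideanSpace ℝ (Fin N))) (α β : ℝ) : H1 Ω →L[ℝ] H1 Ω →L[ℝ] ℝ :=
  α • (innerSL ℝ).bilinearComp (H1.grad Ω) (H1.grad Ω)
    + β • (innerSL ℝ).bilinearComp (H1.toL2 Ω) (H1.toL2 Ω)

theorem ellipticForm_apply (α β : ℝ) (u v : H1 Ω) :
    ellipticForm Ω α β u v
      = α * ⟪H1.grad Ω u, H1.grad Ω v⟫_ℝ + β * ⟪H1.toL2 Ω u, H1.toL2 Ω v⟫_ℝ := by
  simp [ellipticForm]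

theorem isCoercive_ellipticForm {α β : ℝ} (hα : 0 < α) (hβ : 0 < β) :
    IsCoercive (ellipticForm Ω α β) := by
  refine ⟨min α β, lt_min hα hβ, fun u => ?_⟩
  rw [ellipticForm_apply, real_inner_self_eq_norm_sq, real_inner_self_eq_norm_sq, mul_assoc,
    ← pow_two, H1.norm_sq_eq]
  nlinarith [min_le_left α β, min_le_right α β, sq_nonneg ‖H1.grad Ω u‖,
    sq_nonneg ‖H1.toL2 Ω u‖]

/-- The inverse of `-α Δ + β : H¹(Ω) → H¹(Ω)*`. -/
def ellipticSolve (Ω : Set (EuclideanSpace ℝ (Fin N))) {α β : ℝ} (hα : 0 < α) (hβ : 0 < β) :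
    H1Dual Ω →L[ℝ] H1 Ω :=
  (isCoercive_ellipticForm (Ω := Ω) hα hβ).exists_rightInverse.choose

theorem ellipticForm_ellipticSolve {α β : ℝ} (hα : 0 < α) (hβ : 0 < β) (ℓ : H1Dual Ω) :
    ellipticForm Ω α β (ellipticSolve Ω hα hβ ℓ) = ℓ :=
  (isCoercive_ellipticForm (Ω := Ω) hα hβ).exists_rightInverse.choose_spec ℓ

theorem eq_ellipticSolve_iff {α β : ℝ} (hα : 0 < α) (hβ : 0 < β) (ℓ : H1Dual Ω) (u : H1 Ω) :
    u = ellipticSolve Ω hα hβ ℓ ↔ ellipticForm Ω α β u = ℓ := by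
  rw [← (isCoercive_ellipticForm (Ω := Ω) hα hβ).injective.eq_iff, ellipticForm_ellipticSolve]

theorem toH1Dual_apply (v : L2 Ω) (φ : H1 Ω) : L2.toH1Dual Ω v φ = ⟪v, H1.toL2 Ω φ⟫_ℝ := rfl

/-- The energy is quadratic in φ, so its second-order expansion is exact; the linear term is the
residual of the Euler equation. -/
theorem energy_add (α β : ℝ) (ℓ : H1Dual Ω) (φ d : H1 Ω) (q : L2 Ω) :
    energy α β ℓ (φ + d) q = energy α β ℓ φ q
      + (ellipticForm Ω α β φ - (ℓ + β • L2.toH1Dual Ω q)) d + ellipticForm Ω α β d d / 2 := by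
  have e1 : H1.toL2 Ω (φ + d) - q = (H1.toL2 Ω φ - q) + H1.toL2 Ω d := by
    rw [map_add]; abel
  rw [energy, energy, e1, map_add (H1.grad Ω), map_add ℓ, norm_add_sq_real, norm_add_sq_real]
  simp only [sub_apply, add_apply, smul_apply, toH1Dual_apply, ellipticForm_apply, inner_sub_left,
    real_inner_self_eq_norm_sq, smul_eq_mul]
  ring

theorem eq_zero_of_forall_quadratic_nonneg {c k : ℝ} (hk : 0 ≤ k)
    (h : ∀ s : ℝ, 0 ≤ s * c + s ^ 2 * k) : c = 0 := by
  by_contra hc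
  -- The minimizer would be -c/(2k); k + 1 keeps the choice meaningful when k = 0.
  have h1 := h (-c / (2 * (k + 1)))
  have h2 : -c / (2 * (k + 1)) * c + (-c / (2 * (k + 1))) ^ 2 * k
      = -(c ^ 2 * (k + 2)) / (4 * (k + 1) ^ 2) := by
    field_simp; ring
  rw [h2] at h1
  have h3 : 0 < c ^ 2 * (k + 2) / (4 * (k + 1) ^ 2) := by positivity
  rw [neg_div] at h1
  linarith

theorem forall_energy_le_iff {α β : ℝ} (hα : 0 < α) (hβ : 0 < β) (ℓ : H1Dual Ω) (φ : H1 Ω)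
    (q : L2 Ω) : (∀ φ' : H1 Ω, energy α β ℓ φ q ≤ energy α β ℓ φ' q) ↔
      φ = ellipticSolve Ω hα hβ (ℓ + β • L2.toH1Dual Ω q) := by
  have hnn : ∀ d : H1 Ω, 0 ≤ ellipticForm Ω α β d d := by
    intro d
    rw [ellipticForm_apply, real_inner_self_eq_norm_sq, real_inner_self_eq_norm_sq]
    positivity
  rw [eq_ellipticSolve_iff, ← sub_eq_zero]
  constructor
  · intro h
    ext d
    refine eq_zero_of_forall_quadratic_nonneg (k := ellipticForm Ω α β d d / 2)
      (div_nonneg (hnn d) zero_le_two) fun s => ?_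
    have h1 := h (φ + s • d)
    rw [energy_add] at h1
    simp only [map_smul, smul_apply, smul_eq_mul] at h1
    linarith
  · intro h φ'
    have h1 := energy_add α β ℓ φ (φ' - φ) q
    rw [add_sub_cancel, h] at h1
    rw [h1]
    have h2 := hnn (φ' - φ)
    rw [zero_apply]
    linarith

theorem gradient_energy (α β : ℝ) (ℓ : H1Dual Ω) (φ : H1 Ω) (q : L2 Ω) :
    gradient (fun q' : L2 Ω => energy α β ℓ φ q') q = β • (q - H1.toL2 Ω φ) := by
  refine HasGradientAt.gradient ?_
  rw [hasGradientAt_iff_hasFDerivAt]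
  have h1 : HasFDerivAt (fun q' : L2 Ω => H1.toL2 Ω φ - q') (-ContinuousLinearMap.id ℝ (L2 Ω)) q :=
    (hasFDerivAt_id q).const_sub _
  have h2 := ((h1.norm_sq.const_mul (β / 2)).const_add
    (α / 2 * ‖H1.grad Ω φ‖ ^ 2)).sub_const (ℓ φ)
  refine h2.congr_fderiv ?_
  ext d
  simp
  ring

end Elliptic

/-! ### The viscous dissipation and its subdifferential -/

section Dissipation

/-- The function `s ↦ max(0, s) / ε`. -/
def posCut (ε s : ℝ) : ℝ := ε⁻¹ * max 0 s

theorem lipschitzWith_posCut (ε : ℝ) : LipschitzWith ‖ε⁻¹‖₊ (posCut ε) := by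
  have h := (lipschitzWith_smul (β := ℝ) ε⁻¹).comp (LipschitzWith.id.const_max (0 : ℝ))
  rwa [mul_one] at h

/-- The directional derivative of `posCut`. -/
def posCutDeriv (ε v h : ℝ) : ℝ :=
  ε⁻¹ * if 0 < v then h else if v < 0 then 0 else max 0 h

theorem hasDirDerivAt_posCut (ε v h : ℝ) :
    HasDirDerivAt (posCut ε) (posCutDeriv ε v h) v h := by
  have hcont : Tendsto (fun τ : ℝ => v + τ * h) (𝓝[>] 0) (𝓝 v) := by
    have : Tendsto (fun τ : ℝ => v + τ * h) (𝓝 0) (𝓝 (v + 0 * h)) :=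
      Continuous.tendsto (by fun_prop) 0
    simpa using this.mono_left nhdsWithin_le_nhds
  refine tendsto_const_nhds.congr' ?_
  rcases lt_trichotomy v 0 with hv | hv | hv
  · filter_upwards [hcont.eventually_lt_const hv, self_mem_nhdsWithin] with τ h1 hτ
    simp [posCut, posCutDeriv, hv, hv.le, hv.not_gt, max_eq_left h1.le]
  · filter_upwards [self_mem_nhdsWithin] with τ hτ
    have hτ : 0 < τ := hτ
    subst hv
    have : max 0 (τ * h) = τ * max 0 h := by
      rw [mul_max_of_nonneg _ _ hτ.le, mul_zero]
    simp only [posCut, posCutDeriv, lt_irrefl, if_false, zero_add, smul_eq_mul, this, max_self,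
      mul_zero, sub_zero]
    field_simp
  · filter_upwards [hcont.eventually_const_lt hv, self_mem_nhdsWithin] with τ h1 hτ
    have hτ : 0 < τ := hτ
    simp only [posCut, posCutDeriv, hv, if_true, smul_eq_mul, max_eq_right h1.le,
      max_eq_right hv.le]
    field_simp
    ring

variable {N : ℕ} {Ω : Set (EuclideanSpace ℝ (Fin N))} [IsFiniteMeasure (volume.restrict Ω)]

/-- The inclusion says that `η` minimizes θ ↦ (f(ζ) - g, θ) + ε/2 ‖θ‖² over θ ≥ 0. This strongly
convex problem decouples pointwise, and its minimizer is ε⁻¹ max(0, g - f(ζ)). -/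
theorem mem_subdifferential_dissipation_iff {ε : ℝ} (hε : 0 < ε) {f : ℝ → ℝ} {L : ℝ≥0}
    (hf : LipschitzWith L f) (g ζ η : L2 Ω) :
    g ∈ subdifferential (dissipation ε f ζ) η ↔
      η = superpose (lipschitzWith_posCut ε) (g - superpose hf ζ) := by
  set η₀ : L2 Ω := superpose (lipschitzWith_posCut ε) (g - superpose hf ζ) with hη₀
  have hcoe : ∀ᵐ x ∂(volume.restrict Ω), η₀ x = ε⁻¹ * max 0 (g x - superpose hf ζ x) := by
    filter_upwards [coeFn_superpose (lipschitzWith_posCut ε) (g - superpose hf ζ),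
      Lp.coeFn_sub g (superpose hf ζ)] with x h1 h2
    rw [hη₀, h1, h2]
    rfl
  have hpos : ∀ᵐ x ∂(volume.restrict Ω), 0 ≤ η₀ x := by
    filter_upwards [hcoe] with x hx
    rw [hx]
    positivity
  have hint : ∀ θ : L2 Ω, ∫ x in Ω, f (ζ x) * θ x = ⟪superpose hf ζ, θ⟫_ℝ := by
    intro θ
    rw [L2.inner_def]
    refine integral_congr_ae ?_
    filter_upwards [coeFn_superpose hf ζ] with x hx
    rw [hx]
    simp [mul_comm]
  have hdiss : ∀ θ : L2 Ω, (∀ᵐ x ∂(volume.restrict Ω), 0 ≤ θ x) → dissipation ε f ζ θ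
      = ((⟪superpose hf ζ, θ⟫_ℝ + ε / 2 * ‖θ‖ ^ 2 : ℝ) : EReal) := by
    intro θ hθ
    rw [dissipation, if_pos hθ, hint]
  -- Variational inequality at `η₀`, checked pointwise: where g ≤ f(ζ), η₀ = 0 and both factors are
  -- nonnegative; elsewhere the first factor vanishes.
  have hvi : ∀ θ : L2 Ω, (∀ᵐ x ∂(volume.restrict Ω), 0 ≤ θ x) →
      0 ≤ ⟪superpose hf ζ - g + ε • η₀, θ - η₀⟫_ℝ := by
    intro θ hθ
    rw [L2.inner_def]
    refine integral_nonneg_of_ae ?_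
    filter_upwards [hθ, hcoe, Lp.coeFn_add (superpose hf ζ - g) (ε • η₀),
      Lp.coeFn_sub (superpose hf ζ) g, Lp.coeFn_smul ε η₀, Lp.coeFn_sub θ η₀]
      with x h1 h2 h3 h4 h5 h6
    rw [h3, Pi.add_apply, h4, Pi.sub_apply, h5, Pi.smul_apply, h6, Pi.sub_apply, h2]
    simp only [smul_eq_mul, mul_inv_cancel_left₀ hε.ne', RCLike.inner_apply, conj_trivial,
      Pi.zero_apply]
    rcases le_total (g x - superpose hf ζ x) 0 with h | h
    · rw [max_eq_left h, mul_zero, sub_zero, add_zero]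
      exact mul_nonneg h1 (by linarith)
    · rw [max_eq_right h]
      simp
  have hexp : ∀ θ : L2 Ω, ⟪superpose hf ζ - g + ε • η₀, θ - η₀⟫_ℝ + ε / 2 * ‖θ - η₀‖ ^ 2
      = (⟪superpose hf ζ, θ⟫_ℝ + ε / 2 * ‖θ‖ ^ 2) - (⟪superpose hf ζ, η₀⟫_ℝ + ε / 2 * ‖η₀‖ ^ 2)
        - ⟪g, θ - η₀⟫_ℝ := by
    intro θ
    rw [norm_sub_sq_real]
    simp only [inner_add_left, inner_sub_left, inner_sub_right, real_inner_smul_left,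
      real_inner_self_eq_norm_sq, real_inner_comm θ η₀]
    ring
  constructor
  · intro h
    -- Otherwise the functional is ∞ at `η`, and the subgradient inequality fails at `η₀`, where it
    -- is finite.
    have hη : ∀ᵐ x ∂(volume.restrict Ω), 0 ≤ η x := by
      by_contra hη
      have h1 := h η₀
      rw [hdiss η₀ hpos, dissipation, if_neg hη, EReal.top_add_coe, top_le_iff] at h1
      exact EReal.coe_ne_top _ h1
    have h1 := h η₀
    rw [hdiss η₀ hpos, hdiss η hη, ← EReal.coe_add, EReal.coe_le_coe_iff, inner_sub_right] at h1
    have h2 := hexp η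
    rw [inner_sub_right g] at h2
    have h3 := hvi η hη
    have h4 : ε / 2 * ‖η - η₀‖ ^ 2 ≤ 0 := by linarith
    have h5 : ‖η - η₀‖ ^ 2 ≤ 0 := by
      by_contra h6
      have : 0 < ε / 2 * ‖η - η₀‖ ^ 2 := mul_pos (by positivity) (not_le.1 h6)
      linarith
    exact sub_eq_zero.1 (norm_eq_zero.1 (pow_eq_zero_iff (two_ne_zero)
      |>.1 (le_antisymm h5 (sq_nonneg _))))
  · rintro h θ
    rw [h]
    by_cases hθ : ∀ᵐ x ∂(volume.restrict Ω), 0 ≤ θ x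
    · rw [hdiss θ hθ, hdiss η₀ hpos, ← EReal.coe_add, EReal.coe_le_coe_iff]
      have h1 := hexp θ
      have h2 := hvi θ hθ
      have h3 : 0 ≤ ε / 2 * ‖θ - η₀‖ ^ 2 := by positivity
      linarith
    · rw [dissipation, dissipation, if_neg hθ]
      exact le_top

end Dissipation

/-! ### Reduction of the state system to a fixed point equation -/

section State

variable {N : ℕ} {Ω : Set (EuclideanSpace ℝ (Fin N))} {T : ℝ}

/-- The minimizer `φ` of the stored energy `E(ℓ, ·, q)`, pointwise in time. -/
def potential {α β : ℝ} (hα : 0 < α) (hβ : 0 < β) (ℓ : TimeL2 T (H1Dual Ω))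
    (q : TimeL2 T (L2 Ω)) : TimeL2 T (H1 Ω) :=
  affinePotential (ellipticSolve Ω hα hβ) ((ellipticSolve Ω hα hβ).comp (β • L2.toH1Dual Ω)) ℓ q

/-- The operator acting on `q` in the driving force `β (φ - q)`. -/
def forceOfDamage (Ω : Set (EuclideanSpace ℝ (Fin N))) {α β : ℝ} (hα : 0 < α) (hβ : 0 < β) :
    L2 Ω →L[ℝ] L2 Ω :=
  β • ((H1.toL2 Ω).comp ((ellipticSolve Ω hα hβ).comp (β • L2.toH1Dual Ω))
    - ContinuousLinearMap.id ℝ (L2 Ω))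

/-- The operator acting on `ℓ` in the driving force `β (φ - q)`. -/
def forceOfLoad (Ω : Set (EuclideanSpace ℝ (Fin N))) {α β : ℝ} (hα : 0 < α) (hβ : 0 < β) :
    H1Dual Ω →L[ℝ] L2 Ω :=
  β • (H1.toL2 Ω).comp (ellipticSolve Ω hα hβ)

variable {α β : ℝ} (hα : 0 < α) (hβ : 0 < β)

theorem coeFn_potential (ℓ : TimeL2 T (H1Dual Ω)) (q : TimeL2 T (L2 Ω)) :
    potential hα hβ ℓ q =ᵐ[timeMeasure T]
      fun t => ellipticSolve Ω hα hβ (ℓ t + β • L2.toH1Dual Ω (q t)) := by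
  filter_upwards [coeFn_affinePotential (ellipticSolve Ω hα hβ)
    ((ellipticSolve Ω hα hβ).comp (β • L2.toH1Dual Ω)) ℓ q] with t h
  rw [potential, h, map_add]
  rfl

/-- Eliminating φ makes β(φ - q) linear in (q, ℓ), which is the form required by `evolutionMap`. -/
theorem force_eq (ℓ : H1Dual Ω) (q : L2 Ω) :
    forceOfDamage Ω hα hβ q + forceOfLoad Ω hα hβ ℓ
      = β • (H1.toL2 Ω (ellipticSolve Ω hα hβ (ℓ + β • L2.toH1Dual Ω q)) - q) := by
  change β • (H1.toL2 Ω (ellipticSolve Ω hα hβ (β • L2.toH1Dual Ω q)) - q)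
    + β • H1.toL2 Ω (ellipticSolve Ω hα hβ ℓ) = _
  rw [← smul_add, map_add, map_add]
  congr 1
  abel

variable [IsFiniteMeasure (volume.restrict Ω)] {ε : ℝ} {f : ℝ → ℝ} {L : ℝ≥0}
  {H : TimeL2 T (L2 Ω) → TimeL2 T (L2 Ω)}

/-- The operator `q̇ ↦ (1/ε) max(0, -β (q - φ) - f(H(q)))`. -/
def damageMap (ε : ℝ) (hf : LipschitzWith L f) (H : TimeL2 T (L2 Ω) → TimeL2 T (L2 Ω))
    (ℓ : TimeL2 T (H1Dual Ω)) (p : TimeL2 T (L2 Ω)) : TimeL2 T (L2 Ω) :=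
  evolutionMap (lipschitzWith_superpose (lipschitzWith_posCut ε)) (lipschitzWith_superpose hf)
    (forceOfDamage Ω hα hβ) (forceOfLoad Ω hα hβ) H ℓ p

/-- Minimality determines φ from (ℓ, q). Once φ is inserted, the inclusion is the pointwise formula
for q̇, so a state amounts to a fixed point of `damageMap`. -/
theorem isState_iff (hε : 0 < ε) (hf : LipschitzWith L f) (ℓ : TimeL2 T (H1Dual Ω))
    (q : TimeH1 T (L2 Ω)) (φ : TimeL2 T (H1 Ω)) :
    IsState α β ε f H ℓ (q, φ) ↔ TimeH1.ofDeriv T (L2 Ω) q.dt = q ∧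
      φ = potential hα hβ ℓ q.toL2 ∧ damageMap hα hβ ε hf H ℓ q.dt = q.dt := by
  have hmin : (∀ᵐ t ∂(timeMeasure T), ∀ φ' : H1 Ω,
      energy α β (ℓ t) (φ t) (q.toL2 t) ≤ energy α β (ℓ t) φ' (q.toL2 t)) ↔
      φ = potential hα hβ ℓ q.toL2 := by
    simp_rw [forall_energy_le_iff hα hβ]
    constructor
    · exact fun h => Lp.ext (EventuallyEq.trans h (coeFn_potential hα hβ ℓ q.toL2).symm)
    · rintro rfl
      exact coeFn_potential hα hβ ℓ q.toL2
  have hevo : TimeH1.ofDeriv T (L2 Ω) q.dt = q → φ = potential hα hβ ℓ q.toL2 →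
      ((∀ᵐ t ∂(timeMeasure T),
        - gradient (fun q' : L2 Ω => energy α β (ℓ t) (φ t) q') (q.toL2 t) ∈
          subdifferential (dissipation ε f (H q.toL2 t)) (q.dt t)) ↔
      damageMap hα hβ ε hf H ℓ q.dt = q.dt) := by
    intro hq hφ
    have hprim : primitive T (L2 Ω) q.dt = q.toL2 := by
      rw [← TimeH1.toL2_ofDeriv, hq]
    simp_rw [mem_subdifferential_dissipation_iff hε hf, gradient_energy]
    have h1 : damageMap hα hβ ε hf H ℓ q.dt =ᵐ[timeMeasure T]
        fun t => superpose (lipschitzWith_posCut ε)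
          (-(β • (q.toL2 t - H1.toL2 Ω (φ t))) - superpose hf (H q.toL2 t)) := by
      rw [damageMap, evolutionMap, hprim, hφ]
      filter_upwards [coeFn_superpose (lipschitzWith_superpose (lipschitzWith_posCut ε))
        (drivingForce (lipschitzWith_superpose hf) (forceOfDamage Ω hα hβ)
          (forceOfLoad Ω hα hβ) H ℓ q.toL2),
        coeFn_drivingForce (lipschitzWith_superpose hf) (forceOfDamage Ω hα hβ)
          (forceOfLoad Ω hα hβ) H ℓ q.toL2, coeFn_potential hα hβ ℓ q.toL2] with t h2 h3 h4
      rw [h2, h3, h4, force_eq, ← smul_neg, neg_sub]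
    constructor
    · exact fun h => Lp.ext (h1.trans (EventuallyEq.symm h))
    · intro h
      rw [h] at h1
      exact h1
  constructor
  · intro h
    have h1 := h.initial.ofDeriv_dt
    have h2 := hmin.1 h.minimality
    exact ⟨h1, h2, (hevo h1 h2).1 h.evolution⟩
  · rintro ⟨h1, h2, h3⟩
    refine ⟨?_, hmin.2 h2, (hevo h1 h2).2 h3⟩
    change q.VanishesAtZero
    rw [← h1]
    exact TimeH1.vanishesAtZero_ofDeriv q.dt

theorem isState_ofDeriv (hε : 0 < ε) (hf : LipschitzWith L f) {ℓ : TimeL2 T (H1Dual Ω)}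
    {p : TimeL2 T (L2 Ω)} (hp : damageMap hα hβ ε hf H ℓ p = p) :
    IsState α β ε f H ℓ
      (TimeH1.ofDeriv T (L2 Ω) p, potential hα hβ ℓ (primitive T (L2 Ω) p)) :=
  (isState_iff hα hβ hε hf ℓ _ _).2 ⟨rfl, rfl, hp⟩

include hα hβ in
-- `solutionMap` is a choice among states; uniqueness of the fixed point makes the choice
-- irrelevant.
theorem solutionMap_eq (hT : 0 < T) (hε : 0 < ε) (hf : LipschitzWith L f) {K : ℝ} (hK : 0 ≤ K)
    (hH : IsVolterra K H) {ℓ : TimeL2 T (H1Dual Ω)} {s : TimeH1 T (L2 Ω) × TimeL2 T (H1 Ω)}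
    (hs : IsState α β ε f H ℓ s) : solutionMap α β ε f H ℓ = s := by
  have hs' : IsState α β ε f H ℓ (solutionMap α β ε f H ℓ) := 
    Classical.epsilon_spec (p := IsState α β ε f H ℓ) ⟨s, hs⟩
  generalize solutionMap α β ε f H ℓ = s' at hs' ⊢
  obtain ⟨h1, h2, h3⟩ := (isState_iff hα hβ hε hf ℓ s.1 s.2).1 hs
  obtain ⟨h1', h2', h3'⟩ := (isState_iff hα hβ hε hf ℓ s'.1 s'.2).1 hs'
  have h4 := evolutionMap_unique hT _ _ _ _ hK hH ℓ h3' h3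
  have h5 : s'.1 = s.1 := by rw [← h1', h4, h1]
  refine Prod.ext h5 ?_
  rw [h2', h5, ← h2]

end State

/-! ### Pointwise sign of the multiplier terms -/

section Linearization

variable {f : ℝ → ℝ}

theorem HasDirDerivAt.dirDeriv_eq {d v h : ℝ} (H : HasDirDerivAt f d v h) :
    dirDeriv f v h = d :=
  Tendsto.limUnder_eq H

/-- Positive homogeneity in the direction, by the substitution τ ↦ cτ. -/
theorem HasDirDerivAt.mul_pos {d v h c : ℝ} (H : HasDirDerivAt f d v h) (hc : 0 < c) :
    HasDirDerivAt f (c * d) v (c * h) := by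
  have h1 : Tendsto (fun τ : ℝ => c * τ) (𝓝[>] 0) (𝓝[>] 0) := by
    refine tendsto_nhdsWithin_iff.2 ⟨?_, ?_⟩
    · have : Tendsto (fun τ : ℝ => c * τ) (𝓝 0) (𝓝 (c * 0)) := Continuous.tendsto (by fun_prop) 0
      rw [mul_zero] at this
      exact this.mono_left nhdsWithin_le_nhds
    · filter_upwards [self_mem_nhdsWithin] with τ hτ
      exact _root_.mul_pos hc hτ
  refine ((Tendsto.comp H h1).const_mul c).congr' ?_
  filter_upwards [self_mem_nhdsWithin] with τ hτ
  have hτ : 0 < τ := hτ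
  simp only [Function.comp_apply, smul_eq_mul, mul_inv]
  rw [show v + c * τ * h = v + τ * (c * h) by ring]
  field_simp

/-- Away from `nf` both sides agree. At `nf`, d equals f'₊ζ for ζ > 0 and f'₋ζ for ζ < 0, so
multiplying the matching bound on `mu` by ζ gives the claim in each case; the sign of `lam` is
irrelevant. -/
theorem mul_le_mul_of_subgradient {nf v ζ d lam mu : ℝ} (hf : IsFatigueFunction f nf)
    (hd : HasDirDerivAt f d v ζ) (hne : v ≠ nf → mu = deriv f v * lam)
    (heq : v = nf → rightDeriv f nf * lam ≤ mu ∧ mu ≤ leftDeriv f nf * lam) :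
    lam * d ≤ mu * ζ := by
  by_cases hv : v = nf
  · subst hv
    obtain ⟨h1, h2⟩ := heq rfl
    rcases lt_trichotomy ζ 0 with hζ | hζ | hζ
    · obtain ⟨d', hd'⟩ := hf.directional v (-1)
      have h3 := hd'.mul_pos (neg_pos.2 hζ)
      rw [neg_mul_neg, mul_one] at h3
      rw [hd.unique h3]
      rw [leftDeriv, hd'.dirDeriv_eq] at h2
      nlinarith
    · subst hζ
      rw [hd.unique (hasDirDerivAt_zero f v), mul_zero, mul_zero]
    · obtain ⟨d', hd'⟩ := hf.directional v 1
      have h3 := hd'.mul_pos hζ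
      rw [mul_one] at h3
      rw [hd.unique h3]
      rw [rightDeriv, hd'.dirDeriv_eq] at h1
      nlinarith
  · have h1 : HasDirDerivAt f (ζ * deriv f v) v ζ := by
      have h2 := (hf.differentiable v hv).hasFDerivAt.hasLineDerivAt ζ
      simpa [fderiv_eq_smul_deriv] using h2.hasDirDerivAt
    rw [hd.unique h1, hne hv]
    exact le_of_eq (by ring)

/-- Here s - d is the perturbation of z, with s from β(φ - q) and d from f(H(q)). By the previous
lemma it suffices that λ(s - d) ≤ ξ · `posCutDeriv`. For z ≠ 0 this is an equality; for z = 0 it is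
λ(s - d) ≤ λ max(0, s - d) ≤ ε⁻¹ ξ max(0, s - d). -/
theorem pointwise_nonneg {ε nf z v s ζ d ξ lam mu : ℝ}
    (hf : IsFatigueFunction f nf) (hd : HasDirDerivAt f d v ζ)
    (hpos : 0 < z → lam = 1 / ε * ξ) (hneg : z < 0 → lam = 0)
    (hzero : z = 0 → 0 ≤ lam ∧ lam ≤ 1 / ε * ξ)
    (hne : v ≠ nf → mu = deriv f v * lam)
    (heq : v = nf → rightDeriv f nf * lam ≤ mu ∧ mu ≤ leftDeriv f nf * lam) :
    0 ≤ ξ * posCutDeriv ε z (s - d) - lam * s + mu * ζ := by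
  have h1 := mul_le_mul_of_subgradient hf hd hne heq
  suffices h2 : lam * (s - d) ≤ ξ * posCutDeriv ε z (s - d) by linarith
  rcases lt_trichotomy z 0 with hz | hz | hz
  · rw [hneg hz, posCutDeriv, if_neg hz.not_gt, if_pos hz]
    simp
  · obtain ⟨h3, h4⟩ := hzero hz
    rw [posCutDeriv, if_neg hz.not_gt, if_neg hz.not_lt]
    calc lam * (s - d) ≤ lam * max 0 (s - d) :=
          mul_le_mul_of_nonneg_left (le_max_right _ _) h3
      _ ≤ 1 / ε * ξ * max 0 (s - d) := mul_le_mul_of_nonneg_right h4 (le_max_left _ _)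
      _ = ξ * (ε⁻¹ * max 0 (s - d)) := by rw [one_div]; ring
  · rw [hpos hz, posCutDeriv, if_pos hz]
    exact le_of_eq (by rw [one_div]; ring)

/-- Stated for general `E` because it is used twice: over time with values in L²(Ω), then over Ω
with real values. -/
theorem inner_combination_nonneg {S : Type*} [MeasurableSpace S] {μ : Measure S} {E : Type*}
    [NormedAddCommGroup E] [InnerProductSpace ℝ E] {a₁ a₂ b₁ b₂ c₁ c₂ : Lp E 2 μ}
    (h : ∀ᵐ x ∂μ, 0 ≤ ⟪a₁ x, a₂ x⟫_ℝ - ⟪b₁ x, b₂ x⟫_ℝ + ⟪c₁ x, c₂ x⟫_ℝ) :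
    0 ≤ ⟪a₁, a₂⟫_ℝ - ⟪b₁, b₂⟫_ℝ + ⟪c₁, c₂⟫_ℝ := by
  have h1 := (L2.integrable_inner (𝕜 := ℝ) a₁ a₂).sub (L2.integrable_inner (𝕜 := ℝ) b₁ b₂)
  have h2 := integral_add h1 (L2.integrable_inner (𝕜 := ℝ) c₁ c₂)
  have h3 := integral_sub (L2.integrable_inner (𝕜 := ℝ) a₁ a₂)
    (L2.integrable_inner (𝕜 := ℝ) b₁ b₂)
  rw [L2.inner_def, L2.inner_def, L2.inner_def, ← h3]
  refine le_of_le_of_eq ?_ h2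
  exact integral_nonneg_of_ae h

end Linearization

/-! ### Partial derivatives and integrated identities -/

section Generic

variable {E F : Type*} [NormedAddCommGroup E] [NormedSpace ℝ E]
  [NormedAddCommGroup F] [NormedSpace ℝ F]

theorem fderiv_partial_fst {j : E × F → ℝ} {a : E} {b : F} (hj : DifferentiableAt ℝ j (a, b))
    (u : E) : fderiv ℝ j (a, b) (u, 0) = fderiv ℝ (fun x => j (x, b)) a u := by
  have h := (hj.hasFDerivAt.comp a (hasFDerivAt_prodMk_left (𝕜 := ℝ) a b)).fderiv
  exact (congrArg (fun A : E →L[ℝ] ℝ => A u) h).symm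

theorem fderiv_partial_snd {j : E × F → ℝ} {a : E} {b : F} (hj : DifferentiableAt ℝ j (a, b))
    (v : F) : fderiv ℝ j (a, b) (0, v) = fderiv ℝ (fun y => j (a, y)) b v := by
  have h := (hj.hasFDerivAt.comp b (hasFDerivAt_prodMk_right (𝕜 := ℝ) a b)).fderiv
  exact (congrArg (fun A : F →L[ℝ] ℝ => A v) h).symm

theorem fderiv_prod_apply {j : E × F → ℝ} {a : E} {b : F} (hj : DifferentiableAt ℝ j (a, b))
    (u : E) (v : F) : fderiv ℝ j (a, b) (u, v)
      = fderiv ℝ (fun x => j (x, b)) a u + fderiv ℝ (fun y => j (a, y)) b v := by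
  rw [← fderiv_partial_fst hj, ← fderiv_partial_snd hj, ← map_add, Prod.mk_add_mk, add_zero,
    zero_add]

theorem inner_combination_eq {S : Type*} [MeasurableSpace S] {μ : Measure S} {X Y : Type*}
    [NormedAddCommGroup X] [InnerProductSpace ℝ X] [NormedAddCommGroup Y] [InnerProductSpace ℝ Y]
    {a₁ a₂ : Lp X 2 μ} {b₁ b₂ c₁ c₂ d₁ d₂ : Lp Y 2 μ} {α β : ℝ}
    (h : ∀ᵐ x ∂μ, α * ⟪a₁ x, a₂ x⟫_ℝ + β * ⟪b₁ x, b₂ x⟫_ℝ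
      = ⟪c₁ x, c₂ x⟫_ℝ + β * ⟪d₁ x, d₂ x⟫_ℝ) :
    α * ⟪a₁, a₂⟫_ℝ + β * ⟪b₁, b₂⟫_ℝ = ⟪c₁, c₂⟫_ℝ + β * ⟪d₁, d₂⟫_ℝ := by
  have h1 := integral_add ((L2.integrable_inner (𝕜 := ℝ) a₁ a₂).const_mul α)
    ((L2.integrable_inner (𝕜 := ℝ) b₁ b₂).const_mul β)
  have h2 := integral_add (L2.integrable_inner (𝕜 := ℝ) c₁ c₂)
    ((L2.integrable_inner (𝕜 := ℝ) d₁ d₂).const_mul β)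
  rw [integral_const_mul, integral_const_mul] at h1
  rw [integral_const_mul] at h2
  rw [L2.inner_def, L2.inner_def, L2.inner_def, L2.inner_def, ← h1, ← h2]
  exact integral_congr_ae h

end Generic

/-! ### Derivative of the control-to-state map and the adjoint calculus -/

section Sensitivity

variable {N : ℕ} {Ω : Set (EuclideanSpace ℝ (Fin N))} {T α β : ℝ} (hα : 0 < α) (hβ : 0 < β)

/-- The elliptic equation for the potential, tested with `w` and integrated in time; symmetry of the
form lets it be compared with the adjoint equation for `w`. -/
theorem inner_potential (g : TimeH1 T (L2 Ω)) (q : TimeL2 T (L2 Ω)) (w : TimeL2 T (H1 Ω)) :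
    α * ⟪timeGrad w, timeGrad (potential hα hβ (controlToLoad g) q)⟫_ℝ
      + β * ⟪timeH1ToL2 w, timeH1ToL2 (potential hα hβ (controlToLoad g) q)⟫_ℝ
      = ⟪timeH1ToL2 w, g.toL2⟫_ℝ + β * ⟪timeH1ToL2 w, q⟫_ℝ := by
  set φ := potential hα hβ (controlToLoad g) q with hφ
  have hload : controlToLoad g = timeLift (L2.toH1Dual Ω) g.toL2 := rfl
  refine inner_combination_eq ?_
  filter_upwards [coeFn_timeLift (H1.grad Ω) w, coeFn_timeLift (H1.grad Ω) φ,
    coeFn_timeLift (H1.toL2 Ω) w, coeFn_timeLift (H1.toL2 Ω) φ,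
    coeFn_timeLift (F := H1Dual Ω) (L2.toH1Dual Ω) g.toL2,
    coeFn_potential hα hβ (controlToLoad g) q] with t h1 h2 h3 h4 h5 h6
  have e1 : timeGrad w t = H1.grad Ω (w t) := h1
  have e2 : timeGrad φ t = H1.grad Ω (φ t) := h2
  have e3 : timeH1ToL2 w t = H1.toL2 Ω (w t) := h3
  have e4 : timeH1ToL2 φ t = H1.toL2 Ω (φ t) := h4
  rw [← hφ, hload, h5] at h6
  have h7 := congrArg (fun F : H1Dual Ω => F (w t)) ((eq_ellipticSolve_iff hα hβ _ _).1 h6)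
  simp only [ellipticForm_apply, add_apply, smul_apply, toH1Dual_apply, smul_eq_mul] at h7
  rw [e1, e2, e3, e4, real_inner_comm, real_inner_comm (H1.toL2 Ω (φ t)), h7,
    real_inner_comm (H1.toL2 Ω (w t)), real_inner_comm (H1.toL2 Ω (w t)) (q t)]

variable {ε : ℝ} {f : ℝ → ℝ} {nf : ℝ}
  {H : TimeL2 T (L2 Ω) → TimeL2 T (L2 Ω)}
  {H' : TimeH1 T (L2 Ω) → (TimeL2 T (L2 Ω) →L[ℝ] TimeL2 T (L2 Ω))}

set_option maxHeartbeats 1000000 in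
include hα hβ in
/-- Directional differentiability of the control-to-state map, with the equation for the
directional derivative `(q, φ)`. -/
theorem exists_hasDirDerivAt_solutionMap [IsFiniteMeasure (volume.restrict Ω)] (hT : 0 < T) (hε : 0 < ε) (hf : IsFatigueFunction f nf)
    {f' : ℝ → ℝ → ℝ} (hf' : ∀ v h, HasDirDerivAt f (f' v h) v h)
    (hH : IsHistoryOperator H H') {ℓ : TimeL2 T (H1Dual Ω)} {q : TimeH1 T (L2 Ω)}
    {φ : TimeL2 T (H1 Ω)} (hs : IsState α β ε f H ℓ (q, φ)) (δℓ : TimeL2 T (H1Dual Ω)) :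
    ∃ h : TimeL2 T (L2 Ω),
      HasDirDerivAt (solutionMap α β ε f H) (TimeH1.ofDeriv T (L2 Ω) h,
        potential hα hβ δℓ (primitive T (L2 Ω) h)) ℓ δℓ ∧
      ∀ᵐ t ∂(timeMeasure T), ∀ᵐ x ∂(volume.restrict Ω),
        h t x = posCutDeriv ε (zbar β f H q φ t x)
          (β * (H1.toL2 Ω (potential hα hβ δℓ (primitive T (L2 Ω) h) t) x
              - primitive T (L2 Ω) h t x)
            - f' (H q.toL2 t x) (H' q (primitive T (L2 Ω) h) t x)) := by
  obtain ⟨L, -, hL⟩ := hf.lipschitz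
  obtain ⟨K, hK0, hK⟩ := hH.lipschitz
  have hVol : IsVolterra K H := hK
  obtain ⟨hq, hφ, hfix⟩ := (isState_iff hα hβ hε hL ℓ q φ).1 hs
  have hprim : primitive T (L2 Ω) q.dt = q.toL2 := by rw [← TimeH1.toL2_ofDeriv, hq]
  -- Superposition occurs at two levels: f and the positive part act on L²(Ω), and the resulting
  -- Lipschitz maps of L²(Ω) are the P and Q of the abstract equation, superposed in time.
  choose Q' hQ' hQd using exists_hasDirDerivAt_superpose (μ := volume.restrict Ω) hL hf'
  choose P' hP' hPd using exists_hasDirDerivAt_superpose (μ := volume.restrict Ω)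
    (lipschitzWith_posCut ε) (hasDirDerivAt_posCut ε)
  have hsol : ∀ ℓ p, evolutionMap
      (lipschitzWith_superpose (μ := volume.restrict Ω) (lipschitzWith_posCut ε))
      (lipschitzWith_superpose hL) (forceOfDamage Ω hα hβ) (forceOfLoad Ω hα hβ) H ℓ p = p →
      solutionMap α β ε f H ℓ = (TimeH1.ofDeriv T _ p, affinePotential (ellipticSolve Ω hα hβ)
        ((ellipticSolve Ω hα hβ).comp (β • L2.toH1Dual Ω)) ℓ (primitive T _ p)) :=
    fun ℓ p hp => solutionMap_eq hα hβ hT hε hL hK0.le hVol (isState_ofDeriv hα hβ hε hL hp)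
  have hHd : ∀ k, HasDirDerivAt H (H' q k) (primitive T (L2 Ω) q.dt) k := by
    rw [hprim]
    exact fun k => (hH.gateaux q k).hasDirDerivAt
  have hsens := @exists_hasDirDerivAt_solution T (L2 Ω) (H1Dual Ω) _ _ _ _
    (superpose (lipschitzWith_posCut ε)) (superpose hL) _ _ _ (H1 Ω) _ _ hT
    (lipschitzWith_superpose (μ := volume.restrict Ω) (lipschitzWith_posCut ε))
    (lipschitzWith_superpose hL) P' Q' hPd hQd (forceOfDamage Ω hα hβ) (forceOfLoad Ω hα hβ)
  replace hsens := @hsens (ellipticSolve Ω hα hβ)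
  replace hsens := @hsens ((ellipticSolve Ω hα hβ).comp (β • L2.toH1Dual Ω))
  replace hsens := @hsens H K hK0.le hVol (solutionMap α β ε f H)
  replace hsens := hsens hsol
  replace hsens := @hsens ℓ δℓ q.dt hfix (H' q)
  obtain ⟨h, hdir, hh⟩ := hsens hHd
  rw [hprim] at hh
  refine ⟨h, hdir, ?_⟩
  · filter_upwards [hh, coeFn_drivingForce (lipschitzWith_superpose hL) (forceOfDamage Ω hα hβ)
      (forceOfLoad Ω hα hβ) H ℓ q.toL2, coeFn_potential hα hβ ℓ q.toL2,
      coeFn_potential hα hβ δℓ (primitive T (L2 Ω) h)] with t h1 h2 h3 h4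
    -- With φ reinstated, the base point of the derivative becomes β(φ - q) - f(H(q)), that is,
    -- `zbar`.
    rw [force_eq, ← h3, ← hφ] at h2
    rw [force_eq, ← h4, h2] at h1
    rw [h1]
    filter_upwards [hP' (β • (H1.toL2 Ω (φ t) - q.toL2 t) - superpose hL (H q.toL2 t))
      (β • (H1.toL2 Ω (potential hα hβ δℓ (primitive T (L2 Ω) h) t) - primitive T (L2 Ω) h t)
        - Q' (H q.toL2 t) (H' q (primitive T (L2 Ω) h) t)),
      hQ' (H q.toL2 t) (H' q (primitive T (L2 Ω) h) t),
      Lp.coeFn_sub (β • (H1.toL2 Ω (φ t) - q.toL2 t)) (superpose hL (H q.toL2 t)),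
      Lp.coeFn_smul β (H1.toL2 Ω (φ t) - q.toL2 t), Lp.coeFn_sub (H1.toL2 Ω (φ t)) (q.toL2 t),
      coeFn_superpose hL (H q.toL2 t),
      Lp.coeFn_sub (β • (H1.toL2 Ω (potential hα hβ δℓ (primitive T (L2 Ω) h) t)
        - primitive T (L2 Ω) h t)) (Q' (H q.toL2 t) (H' q (primitive T (L2 Ω) h) t)),
      Lp.coeFn_smul β (H1.toL2 Ω (potential hα hβ δℓ (primitive T (L2 Ω) h) t)
        - primitive T (L2 Ω) h t),
      Lp.coeFn_sub (H1.toL2 Ω (potential hα hβ δℓ (primitive T (L2 Ω) h) t))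
        (primitive T (L2 Ω) h t)]
      with x g1 g2 g3 g4 g5 g6 g7 g8 g9
    rw [g1, g3, Pi.sub_apply, g4, Pi.smul_apply, g5, Pi.sub_apply, g6, g7, Pi.sub_apply, g8,
      Pi.smul_apply, g9, Pi.sub_apply, g2, smul_eq_mul, smul_eq_mul, zbar]
    congr 1
    ring

/-- The multipliers of the optimality system act on solutions of the linearized equation with a
sign. -/
theorem OptimalitySystem.sign {j : TimeL2 T (L2 Ω) × TimeL2 T (H1 Ω) → ℝ}
    {ℓ q ξ : TimeH1 T (L2 Ω)} {φ w : TimeL2 T (H1 Ω)} {lam mu : TimeL2 T (L2 Ω)}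
    (hsys : OptimalitySystem α β ε f nf H H' j ℓ q φ ξ w lam mu) (hf : IsFatigueFunction f nf)
    {f' : ℝ → ℝ → ℝ} (hf' : ∀ v h, HasDirDerivAt f (f' v h) v h)
    {h δq : TimeL2 T (L2 Ω)} {δφ : TimeL2 T (H1 Ω)}
    (hh : ∀ᵐ t ∂(timeMeasure T), ∀ᵐ x ∂(volume.restrict Ω),
      h t x = posCutDeriv ε (zbar β f H q φ t x)
        (β * (H1.toL2 Ω (δφ t) x - δq t x) - f' (H q.toL2 t x) (H' q δq t x))) :
    0 ≤ ⟪ξ.toL2, h⟫_ℝ - ⟪lam, β • (timeH1ToL2 δφ - δq)⟫_ℝ + ⟪mu, H' q δq⟫_ℝ := by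
  refine inner_combination_nonneg ?_
  filter_upwards [hh, hsys.lam_eq, hsys.mu_eq, hsys.lam_sign, hsys.mu_sign,
    Lp.coeFn_smul β (timeH1ToL2 δφ - δq), Lp.coeFn_sub (timeH1ToL2 δφ) δq,
    coeFn_timeLift (H1.toL2 Ω) δφ] with t h1 h2 h3 h4 h5 h6 h7 h8
  have h8' : timeH1ToL2 δφ t = H1.toL2 Ω (δφ t) := h8
  rw [h6, Pi.smul_apply, h7, Pi.sub_apply, h8']
  refine inner_combination_nonneg ?_
  filter_upwards [h1, h2, h3, h4, h5, Lp.coeFn_smul β (H1.toL2 Ω (δφ t) - δq t),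
    Lp.coeFn_sub (H1.toL2 Ω (δφ t)) (δq t)] with x k1 k2 k3 k4 k5 k6 k7
  rw [k6, Pi.smul_apply, k7, Pi.sub_apply, k1, smul_eq_mul]
  simp only [RCLike.inner_apply, conj_trivial]
  have := pointwise_nonneg (ε := ε) (z := zbar β f H q φ t x) (v := H q.toL2 t x)
    (s := β * (H1.toL2 Ω (δφ t) x - δq t x)) (ξ := ξ.toL2 t x) (lam := lam t x) (mu := mu t x)
    hf (hf' (H q.toL2 t x) (H' q δq t x)) ?_ ?_ k4 k3 k5
  · linarith
  · intro hz
    rw [k2 hz.ne']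
    simp [hz]
  · intro hz
    rw [k2 hz.ne]
    simp [hz.not_gt]

include hα hβ in
/-- The adjoint equations turn the derivative of the objective into the expression estimated in
`OptimalitySystem.sign`. -/
theorem OptimalitySystem.fderiv_eq {j : TimeL2 T (L2 Ω) × TimeL2 T (H1 Ω) → ℝ}
    {ℓ q ξ : TimeH1 T (L2 Ω)} {φ w : TimeL2 T (H1 Ω)} {lam mu : TimeL2 T (L2 Ω)}
    (hsys : OptimalitySystem α β ε f nf H H' j ℓ q φ ξ w lam mu) (hj : ContDiff ℝ 1 j)
    (δℓ : TimeH1 T (L2 Ω)) (h : TimeL2 T (L2 Ω)) {δq : TimeL2 T (L2 Ω)} {δφ : TimeL2 T (H1 Ω)}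
    (hδq : δq = primitive T (L2 Ω) h) (hδφ : δφ = potential hα hβ (controlToLoad δℓ) δq) :
    fderiv ℝ j (q.toL2, φ) (δq, δφ) + ⟪ℓ, δℓ⟫_ℝ
      = ⟪ξ.toL2, h⟫_ℝ - ⟪lam, β • (timeH1ToL2 δφ - δq)⟫_ℝ + ⟪mu, H' q δq⟫_ℝ := by
  have hd : DifferentiableAt ℝ j (q.toL2, φ) :=
    (hj.differentiable one_ne_zero).differentiableAt
  have e1 : fderiv ℝ (fun q' : TimeL2 T (L2 Ω) => j (q', φ)) q.toL2 δq
      = ⟪- ξ.dt - β • (timeH1ToL2 w - lam) + (H' q).adjoint mu, δq⟫_ℝ := by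
    rw [hsys.adjoint_q, gradient, InnerProductSpace.toDual_symm_apply]
  have e2 := hsys.adjoint_phi δφ
  have e4 := hsys.gradient_eq δℓ
  have e5 := inner_potential hα hβ δℓ δq w
  rw [← hδφ] at e5
  have e6 := hsys.terminal.inner_dt_primitive h
  rw [← hδq] at e6
  have e7 : ⟪(H' q).adjoint mu, δq⟫_ℝ = ⟪mu, H' q δq⟫_ℝ :=
    ContinuousLinearMap.adjoint_inner_left _ _ _
  have e3 : fderiv ℝ j (q.toL2, φ) (δq, δφ) =
      fderiv ℝ (fun q' : TimeL2 T (L2 Ω) => j (q', φ)) q.toL2 δq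
        + fderiv ℝ (fun φ' : TimeL2 T (H1 Ω) => j (q.toL2, φ')) φ δφ :=
    @fderiv_prod_apply (TimeL2 T (L2 Ω)) (TimeL2 T (H1 Ω)) _ _ _ _ j q.toL2 φ hd δq δφ
  -- The terms β(w, δq) cancel between the two adjoint equations, and (w, δℓ) + (ℓ, δℓ) vanishes by
  -- the gradient equation.
  rw [e3, e1, ← e2, inner_add_left, inner_sub_left (-ξ.dt), inner_neg_left, e6, e7,
    real_inner_smul_left, inner_sub_left, inner_sub_left, real_inner_smul_right, inner_sub_right]
  linarith

end Sensitivity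

end

end FatigueDamage
/-- If a control together with its states, some adjoint states and some multipliers satisfies the
optimality system, then it is B-stationary. -/
theorem proposition3p14 {N : ℕ} (Ω : Set (EuclideanSpace ℝ (Fin N)))
    (hΩ_open : IsOpen Ω) (hΩ_bdd : Bornology.IsBounded Ω)
    (T α β ε : ℝ) (hT : 0 < T) (hα : 0 < α) (hβ : 0 < β) (hε : 0 < ε)
    (f : ℝ → ℝ) (nf : ℝ) (hf : FatigueDamage.IsFatigueFunction f nf)
    (H : FatigueDamage.TimeL2 T (FatigueDamage.L2 Ω) → FatigueDamage.TimeL2 T (FatigueDamage.L2 Ω))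
    (H' : FatigueDamage.TimeH1 T (FatigueDamage.L2 Ω) →
      (FatigueDamage.TimeL2 T (FatigueDamage.L2 Ω) →L[ℝ]
        FatigueDamage.TimeL2 T (FatigueDamage.L2 Ω)))
    (hH : FatigueDamage.IsHistoryOperator H H')
    (j : FatigueDamage.TimeL2 T (FatigueDamage.L2 Ω) ×
      FatigueDamage.TimeL2 T (FatigueDamage.H1 Ω) → ℝ)
    (hj : ContDiff ℝ 1 j)
    (ℓ q ξ : FatigueDamage.TimeH1 T (FatigueDamage.L2 Ω))
    (φ w : FatigueDamage.TimeL2 T (FatigueDamage.H1 Ω))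
    (lam mu : FatigueDamage.TimeL2 T (FatigueDamage.L2 Ω))
    (hstate : FatigueDamage.IsState α β ε f H (FatigueDamage.controlToLoad ℓ) (q, φ))
    (hsys : FatigueDamage.OptimalitySystem α β ε f nf H H' j ℓ q φ ξ w lam mu) :
    FatigueDamage.IsBStationary α β ε f H j ℓ := by
  -- Boundedness of Ω is used here: constants such as f(0) must lie in L²(Ω).
  have : IsFiniteMeasure (volume.restrict Ω) :=
    isFiniteMeasure_restrict.2 hΩ_bdd.measure_lt_top.ne
  intro δℓ
  choose f' hf' using hf.directional
  obtain ⟨L, -, hL⟩ := hf.lipschitz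
  obtain ⟨K, hK0, hK⟩ := hH.lipschitz
  obtain ⟨h, hdir, hh⟩ := FatigueDamage.exists_hasDirDerivAt_solutionMap hα hβ hT hε hf hf' hH
    hstate (FatigueDamage.controlToLoad δℓ)
  refine ⟨_, hdir, ?_⟩
  rw [FatigueDamage.solutionMap_eq hα hβ hT hε hL hK0.le hK hstate,
    FatigueDamage.TimeH1.toL2_ofDeriv, hsys.fderiv_eq hα hβ hj δℓ h rfl rfl]
  exact hsys.sign hf hf' hh
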